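/- Let $H$ be a Hilbert $C^*$-module over a $C^*$-algebra $\mathfrak{A}$ and let $\mathcal{L}(H)$ be the $C^*$-algebra of adjointable operators on $H$. For $T\in\mathcal{L}(H)$ let $\mathcal{R}(T)$ and $\mathcal{N}(T)$ denote its range and null space, and for a submodule $M$ with $H=M+M^\perp$ (an orthogonally complemented submodule) let $P_M$ be the projection of $H$ onto $M$. Let $Q\in\mathcal{L}(H)$ be an idempotent ($Q^2=Q$) that is not a projection ($Q\neq Q^*$), and let $$m(Q)=\tfrac12\big(|Q^*|+Q^*\big)\,|Q^*|^\dagger\,\big(|Q^*|+I\big)^{-1}\big(|Q^*|+Q\big)$$ be its matched projection, where $|Q^*|=(QQ^*)^{1/2}$ and $\dagger$ denotes the Moore--Penrose inverse. Put $$H_1=\mathcal{R}(m(Q))\cap\mathcal{R}(Q),\qquad H_4=\mathcal{N}(m(Q))\cap\mathcal{N}(Q),$$ $$H_5=\overline{\mathcal{R}\big(m(Q)\,Q\,(I-m(Q))\big)},\qquad H_6=\overline{\mathcal{R}\big((I-m(Q))\,Q\,m(Q)\big)},$$ and assume that the matched pair $(m(Q),Q)$ is harmonious, i.e. that $H_5$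 and $H_6$ are orthogonally complemented in $H$. Then $H_1$, $H_4$, $\mathcal{R}(Q)$ and $\mathcal{N}(Q)$ are orthogonally complemented as well, and $$W:H\to H_1\oplus H_4\oplus H_5\oplus H_6,\qquad Wx=(P_{H_1}x,\,P_{H_4}x,\,P_{H_5}x,\,P_{H_6}x)^T,$$ is a unitary operator. Moreover, there are $A\in\mathcal{L}(H_5)$ with $A\ge I_{H_5}$ and $\overline{\mathcal{R}(A-I_{H_5})}=H_5$, and a unitary operator $U\in\mathcal{L}(H_5,H_6)$, such that $$W\,m(Q)\,W^*=I_{H_1}\oplus 0_{H_4}\oplus I_{H_5}\oplus 0_{H_6},$$ $$W\,Q\,W^*=I_{H_1}\oplus 0_{H_4}\oplus\begin{pmatrix}A&-A^{1/2}(A-I_{H_5})^{1/2}U^*\\ UA^{1/2}(A-I_{H_5})^{1/2}&U(I_{H_5}-A)U^*\end{pmatrix},$$ $2A-I_{H_5}$ is invertible, $B=A(2A-I_{H_5})^{-1}\in\mathcal{L}(H_5)$ is a positive contraction, and $$W\,P_{\mathcal{R}(Q)}\,W^*=I_{H_1}\oplus 0_{H_4}\oplus\begin{pmatrix}B&B^{1/2}(I_{H_5}-B)^{1/2}U^*\\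 UB^{1/2}(I_{H_5}-B)^{1/2}&U(I_{H_5}-B)U^*\end{pmatrix},$$ $$W\,P_{\mathcal{N}(Q)}\,W^*=0_{H_1}\oplus I_{H_4}\oplus\begin{pmatrix}I_{H_5}-B&B^{1/2}(I_{H_5}-B)^{1/2}U^*\\ UB^{1/2}(I_{H_5}-B)^{1/2}&UBU^*\end{pmatrix}.$$ -/

import Mathlib

open scoped InnerProductSpace

set_option linter.unusedSectionVars false

noncomputable section

namespace HilbertMod

/-! ## Adjointable operators -/

section Adj

variable (𝔄 : Type*) {H K : Type*} [NonUnitalCStarAlgebra 𝔄] [PartialOrder 𝔄]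
  [NormedAddCommGroup H] [NormedSpace ℂ H] [SMul 𝔄 H] [CStarModule 𝔄 H]
  [NormedAddCommGroup K] [NormedSpace ℂ K] [SMul 𝔄 K] [CStarModule 𝔄 K]

/-- `S` is an adjoint of `T` for the `𝔄`-valued inner products. -/
def IsAdjointPair (T : H →L[ℂ] K) (S : K →L[ℂ] H) : Prop :=
  ∀ x y, ⟪T x, y⟫_𝔄 = ⟪x, S y⟫_𝔄

/-- `T` belongs to `𝓛(H, K)`. -/
def IsAdjointable (T : H →L[ℂ] K) : Prop :=
  ∃ S : K →L[ℂ] H, IsAdjointPair 𝔄 T S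

open Classical in
/-- The adjoint `T*` of an adjointable operator `T` (and `0` if `T` is not adjointable). -/
def adj (T : H →L[ℂ] K) : K →L[ℂ] H :=
  if h : IsAdjointable 𝔄 T then h.choose else 0

/-- A unitary operator in `𝓛(H, K)`: adjointable with `U* U = I` and `U U* = I`. -/
def IsUnitaryOp (U : H →L[ℂ] K) : Prop :=
  IsAdjointable 𝔄 U ∧ adj 𝔄 U ∘L U = ContinuousLinearMap.id ℂ H ∧
    U ∘L adj 𝔄 U = ContinuousLinearMap.id ℂ K

variable {𝔄}

theorem ext_inner {x y : H} (h : ∀ z : H, ⟪z, x⟫_𝔄 = ⟪z, y⟫_𝔄) : x = y := by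
  have h1 := h (x - y)
  rw [← sub_eq_zero, ← CStarModule.inner_sub_right, CStarModule.inner_self] at h1
  exact sub_eq_zero.mp h1

theorem IsAdjointPair.symm {T : H →L[ℂ] K} {S : K →L[ℂ] H} (h : IsAdjointPair 𝔄 T S) :
    IsAdjointPair 𝔄 S T := fun x y => by
  rw [← CStarModule.star_inner, ← h, CStarModule.star_inner]

theorem IsAdjointPair.unique {T : H →L[ℂ] K} {S S' : K →L[ℂ] H} (h : IsAdjointPair 𝔄 T S)
    (h' : IsAdjointPair 𝔄 T S') : S = S' :=
  ContinuousLinearMap.ext fun y => ext_inner (𝔄 := 𝔄) fun z => by rw [← h, ← h']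

theorem IsAdjointable.pair {T : H →L[ℂ] K} (h : IsAdjointable 𝔄 T) :
    IsAdjointPair 𝔄 T (adj 𝔄 T) := by
  rw [adj, dif_pos h]; exact h.choose_spec

theorem IsAdjointPair.adj_eq {T : H →L[ℂ] K} {S : K →L[ℂ] H} (h : IsAdjointPair 𝔄 T S) :
    adj 𝔄 T = S :=
  (IsAdjointable.pair ⟨S, h⟩).unique h

/-- Adjointable operators are `𝔄`-linear. -/
theorem IsAdjointable.map_smul {T : H →L[ℂ] K} (h : IsAdjointable 𝔄 T) (a : 𝔄) (x : H) :
    T (a • x) = a • T x := by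
  obtain ⟨S, hS⟩ := h
  refine ext_inner (𝔄 := 𝔄) fun z => ?_
  rw [← hS.symm, CStarModule.inner_op_smul_right, CStarModule.inner_op_smul_right, hS.symm]

end Adj

/-! ## The C⋆-algebra `𝓛(H)` -/

section Algebra

variable (𝔄 H : Type*) [NonUnitalCStarAlgebra 𝔄] [PartialOrder 𝔄] [StarOrderedRing 𝔄]
  [NormedAddCommGroup H] [NormedSpace ℂ H] [SMul 𝔄 H] [CStarModule 𝔄 H]

/-- The adjointable operators on `H`, as a subalgebra of the bounded operators. -/
def adjointableSubalgebra : Subalgebra ℂ (H →L[ℂ] H) where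
  carrier := {T | IsAdjointable 𝔄 T}
  mul_mem' := by
    rintro T T' ⟨S, hS⟩ ⟨S', hS'⟩
    exact ⟨S' * S, fun x y => by
      rw [mul_apply_eq_comp, mul_apply_eq_comp, hS, hS']⟩
  add_mem' := by
    rintro T T' ⟨S, hS⟩ ⟨S', hS'⟩
    exact ⟨S + S', fun x y => by simp [hS x y, hS' x y]⟩
  algebraMap_mem' := fun c =>
    ⟨algebraMap ℂ _ (star c), fun x y => by
      simp [Algebra.algebraMap_eq_smul_one]⟩

/-- `𝓛(H)`. -/
def Adjointable : Type _ := ↥(adjointableSubalgebra 𝔄 H)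

namespace Adjointable

instance : NormedRing (Adjointable 𝔄 H) :=
  inferInstanceAs (NormedRing ↥(adjointableSubalgebra 𝔄 H))

instance : NormedAlgebra ℂ (Adjointable 𝔄 H) :=
  inferInstanceAs (NormedAlgebra ℂ ↥(adjointableSubalgebra 𝔄 H))

variable {𝔄 H}

/-- The bounded operator underlying an element of `𝓛(H)`. -/
def toCLM (T : Adjointable 𝔄 H) : H →L[ℂ] H := T.1

theorem isAdjointable (T : Adjointable 𝔄 H) : IsAdjointable 𝔄 T.toCLM := T.2

@[ext] theorem ext {T S : Adjointable 𝔄 H} (h : T.toCLM = S.toCLM) : T = S := Subtype.ext h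

@[simp] theorem toCLM_mul (T S : Adjointable 𝔄 H) : (T * S).toCLM = T.toCLM * S.toCLM := rfl
@[simp] theorem toCLM_add (T S : Adjointable 𝔄 H) : (T + S).toCLM = T.toCLM + S.toCLM := rfl
@[simp] theorem toCLM_sub (T S : Adjointable 𝔄 H) : (T - S).toCLM = T.toCLM - S.toCLM := rfl
@[simp] theorem toCLM_one : (1 : Adjointable 𝔄 H).toCLM = 1 := rfl
@[simp] theorem toCLM_zero : (0 : Adjointable 𝔄 H).toCLM = 0 := rfl
@[simp] theorem toCLM_smul (c : ℂ) (T : Adjointable 𝔄 H) : (c • T).toCLM = c • T.toCLM := rfl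
theorem norm_toCLM (T : Adjointable 𝔄 H) : ‖T.toCLM‖ = ‖T‖ := rfl

instance : Star (Adjointable 𝔄 H) :=
  ⟨fun T => ⟨adj 𝔄 T.toCLM, T.toCLM, T.isAdjointable.pair.symm⟩⟩

@[simp] theorem toCLM_star (T : Adjointable 𝔄 H) : (star T).toCLM = adj 𝔄 T.toCLM := rfl

theorem pair_star (T : Adjointable 𝔄 H) : IsAdjointPair 𝔄 T.toCLM (star T).toCLM :=
  T.isAdjointable.pair

theorem star_eq {T S : Adjointable 𝔄 H} (h : IsAdjointPair 𝔄 T.toCLM S.toCLM) : star T = S :=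
  ext h.adj_eq

instance : StarRing (Adjointable 𝔄 H) where
  star_involutive T := star_eq T.pair_star.symm
  star_mul T S := star_eq fun x y => by
    simp only [toCLM_mul, mul_apply_eq_comp]
    rw [T.pair_star, S.pair_star]
  star_add T S := star_eq fun x y => by
    simp only [toCLM_add, add_apply, CStarModule.inner_add_left,
      CStarModule.inner_add_right]
    rw [T.pair_star, S.pair_star]

instance : StarModule ℂ (Adjointable 𝔄 H) where
  star_smul c T := star_eq fun x y => by
    simp only [toCLM_smul, smul_apply, CStarModule.inner_smul_left_complex,
      CStarModule.inner_smul_right_complex]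
    rw [T.pair_star]

theorem norm_sq_le (T : Adjointable 𝔄 H) : ‖T‖ * ‖T‖ ≤ ‖star T * T‖ := by
  rw [← pow_two, ← Real.sqrt_le_sqrt_iff (norm_nonneg _), Real.sqrt_sq (norm_nonneg _),
    ← norm_toCLM]
  refine ContinuousLinearMap.opNorm_le_bound _ (Real.sqrt_nonneg _) fun x => ?_
  rw [← Real.sqrt_sq (norm_nonneg x), ← Real.sqrt_mul (norm_nonneg _)]
  refine Real.le_sqrt_of_sq_le ?_
  rw [CStarModule.norm_sq_eq 𝔄, T.pair_star]
  calc ‖⟪x, (star T).toCLM (T.toCLM x)⟫_𝔄‖ ≤ ‖x‖ * ‖(star T * T).toCLM x‖ :=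
        CStarModule.norm_inner_le H
    _ ≤ ‖x‖ * (‖(star T * T).toCLM‖ * ‖x‖) := by
        gcongr; exact ContinuousLinearMap.le_opNorm _ _
    _ = ‖star T * T‖ * ‖x‖ ^ 2 := by rw [norm_toCLM]; ring

instance : CStarRing (Adjointable 𝔄 H) := ⟨norm_sq_le⟩

instance [CompleteSpace H] : CompleteSpace (Adjointable 𝔄 H) := by
  refine Metric.complete_of_cauchySeq_tendsto fun u hu => ?_
  have hc : CauchySeq fun n => (u n).toCLM := by
    rw [Metric.cauchySeq_iff] at hu ⊢
    exact hu
  have hs : CauchySeq fun n => (star (u n)).toCLM := by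
    rw [Metric.cauchySeq_iff] at hu ⊢
    intro ε hε
    obtain ⟨N, hN⟩ := hu ε hε
    refine ⟨N, fun m hm n hn => ?_⟩
    rw [dist_eq_norm, ← toCLM_sub, norm_toCLM, ← star_sub, norm_star, ← dist_eq_norm]
    exact hN m hm n hn
  obtain ⟨T, hT⟩ := cauchySeq_tendsto_of_complete hc
  obtain ⟨S, hS⟩ := cauchySeq_tendsto_of_complete hs
  have hTS : IsAdjointPair 𝔄 T S := fun x y => by
    have h1 : Filter.Tendsto (fun n => (u n).toCLM x) Filter.atTop (nhds (T x)) :=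
      ((ContinuousLinearMap.apply ℂ H x).continuous.tendsto T).comp hT
    have h2 : Filter.Tendsto (fun n => (star (u n)).toCLM y) Filter.atTop (nhds (S y)) :=
      ((ContinuousLinearMap.apply ℂ H y).continuous.tendsto S).comp hS
    have h3 : Filter.Tendsto (fun n => ⟪(u n).toCLM x, y⟫_𝔄) Filter.atTop
        (nhds ⟪T x, y⟫_𝔄) :=
      (CStarModule.continuous_inner.tendsto (T x, y)).comp (h1.prodMk_nhds tendsto_const_nhds)
    have h4 : Filter.Tendsto (fun n => ⟪x, (star (u n)).toCLM y⟫_𝔄) Filter.atTop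
        (nhds ⟪x, S y⟫_𝔄) :=
      (CStarModule.continuous_inner.tendsto (x, S y)).comp (tendsto_const_nhds.prodMk_nhds h2)
    refine tendsto_nhds_unique h3 (h4.congr fun n => ?_)
    exact ((u n).pair_star x y).symm
  have hlim := Metric.tendsto_atTop.mp hT
  exact ⟨(⟨T, S, hTS⟩ : ↥(adjointableSubalgebra 𝔄 H)), Metric.tendsto_atTop.mpr hlim⟩

variable [CompleteSpace H]

instance : CStarAlgebra (Adjointable 𝔄 H) where

/-- The order of the C⋆-algebra `𝓛(H)`: `T ≤ S` iff `S - T` is self-adjoint with spectrum in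
`[0, ∞)`. -/
instance : PartialOrder (Adjointable 𝔄 H) := CStarAlgebra.spectralOrder _

instance : StarOrderedRing (Adjointable 𝔄 H) := CStarAlgebra.spectralOrderedRing _

end Adjointable

end Algebra

/-! ## Submodules of a Hilbert module -/

section Submodules

variable (𝔄 H : Type*) [NonUnitalCStarAlgebra 𝔄] [PartialOrder 𝔄]
  [NormedAddCommGroup H] [NormedSpace ℂ H] [SMul 𝔄 H] [CStarModule 𝔄 H]

/-- A complex subspace of `H` that is stable under the action of `𝔄`. -/
structure Sub extends Submodule ℂ H where
  action_mem : ∀ (a : 𝔄) {x : H}, x ∈ carrier → a • x ∈ carrier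

variable {𝔄 H}

/-- The elements of a submodule, with the inner product and the norm restricted from `H`. -/
abbrev Sub.Elem (M : Sub 𝔄 H) : Type _ := ↥M.toSubmodule

instance (M : Sub 𝔄 H) : SMul 𝔄 M.Elem := ⟨fun a x => ⟨a • x.1, M.action_mem a x.2⟩⟩

instance (M : Sub 𝔄 H) : CStarModule 𝔄 M.Elem where
  inner x y := ⟪(x : H), (y : H)⟫_𝔄
  inner_add_right := CStarModule.inner_add_right
  inner_self_nonneg := CStarModule.inner_self_nonneg
  inner_self := CStarModule.inner_self.trans Submodule.coe_eq_zero
  inner_op_smul_right := CStarModule.inner_op_smul_right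
  inner_smul_right_complex := CStarModule.inner_smul_right_complex
  star_inner x y := CStarModule.star_inner (x : H) (y : H)
  norm_eq_sqrt_norm_inner_self x := CStarModule.norm_eq_sqrt_norm_inner_self (x : H)

/-- The intersection `M ∩ N`. -/
def Sub.inter (M N : Sub 𝔄 H) : Sub 𝔄 H where
  toSubmodule := M.toSubmodule ⊓ N.toSubmodule
  action_mem a _ hx := ⟨M.action_mem a hx.1, N.action_mem a hx.2⟩

/-- `M` is orthogonally complemented: `H = M + M^⊥`. -/
def Sub.IsOrthComplemented (M : Sub 𝔄 H) : Prop :=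
  ∀ x : H, ∃ y ∈ M.toSubmodule, ∃ z : H, (∀ w ∈ M.toSubmodule, ⟪z, w⟫_𝔄 = 0) ∧ x = y + z

theorem Sub.decomp_unique (M : Sub 𝔄 H) {y y' z z' : H} (hy : y ∈ M.toSubmodule)
    (hy' : y' ∈ M.toSubmodule) (hz : ∀ w ∈ M.toSubmodule, ⟪z, w⟫_𝔄 = 0)
    (hz' : ∀ w ∈ M.toSubmodule, ⟪z', w⟫_𝔄 = 0) (h : y + z = y' + z') : y = y' := by
  have e : y - y' = z' - z := by
    rw [sub_eq_sub_iff_add_eq_add, h, add_comm]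
  have hm : y - y' ∈ M.toSubmodule := sub_mem hy hy'
  have h0 : ⟪y - y', y - y'⟫_𝔄 = 0 := by
    nth_rewrite 1 [e]
    rw [CStarModule.inner_sub_left, hz _ hm, hz' _ hm, sub_zero]
  exact sub_eq_zero.mp (CStarModule.inner_self.mp h0)

variable [StarOrderedRing 𝔄]

theorem Sub.norm_le_of_orthogonal {y z : H} (h : ⟪y, z⟫_𝔄 = 0) : ‖y‖ ≤ ‖y + z‖ := by
  have h' : ⟪z, y⟫_𝔄 = 0 := by rw [← CStarModule.star_inner, h, star_zero]
  rw [CStarModule.norm_eq_sqrt_norm_inner_self (A := 𝔄) y,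
    CStarModule.norm_eq_sqrt_norm_inner_self (A := 𝔄) (y + z)]
  refine Real.sqrt_le_sqrt (CStarAlgebra.norm_le_norm_of_nonneg_of_le
    CStarModule.inner_self_nonneg ?_)
  have e : ⟪y + z, y + z⟫_𝔄 = ⟪y, y⟫_𝔄 + ⟪z, z⟫_𝔄 := by simp [h, h']
  rw [e]
  exact le_add_of_nonneg_right CStarModule.inner_self_nonneg

open Classical in
/-- The orthogonal projection `x ↦ P_M x`, as an operator from `H` to an orthogonally
complemented submodule `M` (and `0` if `M` is not orthogonally complemented). -/
def Sub.projTo (M : Sub 𝔄 H) : H →L[ℂ] M.Elem :=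
  if h : M.IsOrthComplemented then
    LinearMap.mkContinuous
      { toFun := fun x => ⟨(h x).choose, (h x).choose_spec.1⟩
        map_add' := fun x x' => Subtype.ext <| by
          obtain ⟨hy, z, hz, e⟩ := (h x).choose_spec
          obtain ⟨hy', z', hz', e'⟩ := (h x').choose_spec
          obtain ⟨hs, t, ht, es⟩ := (h (x + x')).choose_spec
          refine M.decomp_unique (z := t) (z' := z + z') hs (add_mem hy hy') ht
            (fun w hw => by rw [CStarModule.inner_add_left, hz w hw, hz' w hw, add_zero]) ?_
          refine es.symm.trans ((congrArg₂ (· + ·) e e').trans ?_)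
          exact add_add_add_comm _ _ _ _
        map_smul' := fun c x => Subtype.ext <| by
          obtain ⟨hy, z, hz, e⟩ := (h x).choose_spec
          obtain ⟨hs, t, ht, es⟩ := (h (c • x)).choose_spec
          refine M.decomp_unique (z := t) (z' := c • z) hs (Submodule.smul_mem _ c hy) ht
            (fun w hw => by rw [CStarModule.inner_smul_left_complex, hz w hw, smul_zero]) ?_
          exact es.symm.trans ((congrArg (c • ·) e).trans (smul_add c _ z)) }
      1 (fun x => by
        obtain ⟨hy, z, hz, e⟩ := (h x).choose_spec
        rw [one_mul]
        refine le_of_le_of_eq (Sub.norm_le_of_orthogonal (𝔄 := 𝔄) (z := z) ?_)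
          (congrArg norm e.symm)
        rw [← CStarModule.star_inner]
        exact (congrArg star (hz _ hy)).trans (star_zero _))
  else 0

theorem Sub.projTo_eq {M : Sub 𝔄 H} (h : M.IsOrthComplemented) {x y z : H}
    (hy : y ∈ M.toSubmodule) (hz : ∀ w ∈ M.toSubmodule, ⟪z, w⟫_𝔄 = 0) (e : x = y + z) :
    (M.projTo x : H) = y := by
  obtain ⟨hs, t, ht, es⟩ := (h x).choose_spec
  rw [Sub.projTo, dif_pos h]
  exact M.decomp_unique hs hy ht hz (es.symm.trans e)

theorem Sub.inner_projTo (M : Sub 𝔄 H) (x y : H) :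
    ⟪(M.projTo x : H), y⟫_𝔄 = ⟪x, (M.projTo y : H)⟫_𝔄 := by
  by_cases h : M.IsOrthComplemented
  · obtain ⟨u, hu, z, hz, e⟩ := h x
    obtain ⟨v, hv, t, ht, e'⟩ := h y
    rw [Sub.projTo_eq h hu hz e, Sub.projTo_eq h hv ht e', e, e', CStarModule.inner_add_right,
      CStarModule.inner_add_left, hz v hv, ← CStarModule.star_inner t u, ht u hu, star_zero]
  · rw [Sub.projTo, dif_neg h]; simp

/-- The projection `P_M ∈ 𝓛(H)` onto an orthogonally complemented submodule `M`
(and `0` if `M` is not orthogonally complemented). -/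
def Sub.proj (M : Sub 𝔄 H) : Adjointable 𝔄 H :=
  ⟨M.toSubmodule.subtypeL ∘L M.projTo, M.toSubmodule.subtypeL ∘L M.projTo, M.inner_projTo⟩

/-- The closure of a submodule. -/
def Sub.closure (M : Sub 𝔄 H) : Sub 𝔄 H where
  toSubmodule := M.toSubmodule.topologicalClosure
  action_mem a x hx := by
    have hlip : LipschitzWith ‖a‖₊ (fun x : H => a • x) := by
      have hsub : ∀ x y : H, a • x - a • y = a • (x - y) := fun x y =>
        ext_inner (𝔄 := 𝔄) fun z => by
          simp only [CStarModule.inner_sub_right, CStarModule.inner_op_smul_right, mul_sub]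
      refine LipschitzWith.of_dist_le_mul fun x y => ?_
      rw [dist_eq_norm, dist_eq_norm, hsub]
      refine (pow_le_pow_iff_left₀ (norm_nonneg _) (by positivity) two_ne_zero).mp ?_
      rw [CStarModule.norm_sq_eq 𝔄, CStarModule.inner_op_smul_right,
        CStarModule.inner_op_smul_left, mul_pow, CStarModule.norm_sq_eq 𝔄]
      refine (norm_mul_le _ _).trans ?_
      refine (mul_le_mul_of_nonneg_left (norm_mul_le _ _) (norm_nonneg _)).trans ?_
      rw [norm_star, coe_nnnorm]
      exact le_of_eq (by ring)
    exact map_mem_closure hlip.continuous hx fun y hy => M.action_mem a hy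

instance [CompleteSpace H] (M : Sub 𝔄 H) : CompleteSpace M.closure.Elem :=
  inferInstanceAs (CompleteSpace ↥M.toSubmodule.topologicalClosure)

/-- The range `𝓡(T)`. -/
def Adjointable.range (T : Adjointable 𝔄 H) : Sub 𝔄 H where
  toSubmodule := LinearMap.range (T.toCLM : H →ₗ[ℂ] H)
  action_mem := by
    rintro a _ ⟨x, rfl⟩
    exact ⟨a • x, T.isAdjointable.map_smul a x⟩

/-- The null space `𝓝(T)`. -/
def Adjointable.ker (T : Adjointable 𝔄 H) : Sub 𝔄 H where
  toSubmodule := LinearMap.ker (T.toCLM : H →ₗ[ℂ] H)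
  action_mem a x hx := by
    have h0 : T.toCLM x = 0 := hx
    change T.toCLM (a • x) = 0
    rw [T.isAdjointable.map_smul, h0]
    refine ext_inner (𝔄 := 𝔄) fun z => ?_
    rw [CStarModule.inner_op_smul_right, CStarModule.inner_zero_right, mul_zero]

end Submodules

/-! ## The submodules attached to a pair `(P, Q)`, and the matched projection -/

section Pairs

variable {𝔄 H : Type*} [NonUnitalCStarAlgebra 𝔄] [PartialOrder 𝔄] [StarOrderedRing 𝔄]
  [NormedAddCommGroup H] [NormedSpace ℂ H] [SMul 𝔄 H] [CStarModule 𝔄 H]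

/-- `H₁ = 𝓡(P) ∩ 𝓡(Q)`. -/
def H₁ (P Q : Adjointable 𝔄 H) : Sub 𝔄 H := P.range.inter Q.range

/-- `H₄ = 𝓝(P) ∩ 𝓝(Q)`. -/
def H₄ (P Q : Adjointable 𝔄 H) : Sub 𝔄 H := P.ker.inter Q.ker

/-- `H₅` is the closure of the range of `P Q (I - P)`. -/
abbrev H₅ (P Q : Adjointable 𝔄 H) : Sub 𝔄 H := (Adjointable.range (P * Q * (1 - P))).closure

/-- `H₆` is the closure of the range of `(I - P) Q P`. -/
abbrev H₆ (P Q : Adjointable 𝔄 H) : Sub 𝔄 H := (Adjointable.range ((1 - P) * Q * P)).closure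

/-- Harmony of a quasi-projection pair `(P, Q)`: both `H₅` and `H₆` are orthogonally
complemented. -/
def IsHarmonious (P Q : Adjointable 𝔄 H) : Prop :=
  (H₅ P Q).IsOrthComplemented ∧ (H₆ P Q).IsOrthComplemented

/-- `X` is the Moore-Penrose inverse of `T`. -/
def IsMoorePenroseInverse (T X : Adjointable 𝔄 H) : Prop :=
  T * X * T = T ∧ X * T * X = X ∧ star (T * X) = T * X ∧ star (X * T) = X * T

open Classical in
/-- The Moore-Penrose inverse `T†` (and `0` if there is none). -/
def mpInverse (T : Adjointable 𝔄 H) : Adjointable 𝔄 H :=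
  if h : ∃ X, IsMoorePenroseInverse T X then h.choose else 0

/-- The matched projection
`m(Q) = (1/2) (|Q*| + Q*) |Q*|† (|Q*| + I)⁻¹ (|Q*| + Q)` of an idempotent `Q`. -/
def matchedProj [CompleteSpace H] (Q : Adjointable 𝔄 H) : Adjointable 𝔄 H :=
  (1 / 2 : ℂ) • ((CFC.abs (star Q) + star Q) * mpInverse (CFC.abs (star Q)) *
    Ring.inverse (CFC.abs (star Q) + 1) * (CFC.abs (star Q) + Q))

end Pairs

/-! ## Direct sums and block matrices -/

section Blocks

variable (𝔄 : Type*) [NonUnitalCStarAlgebra 𝔄] [PartialOrder 𝔄] [StarOrderedRing 𝔄]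

/-- The Hilbert module `E ⊕ F`, with `⟪(x, y), (x', y')⟫ = ⟪x, x'⟫ + ⟪y, y'⟫`. -/
abbrev DSum (E F : Type*) : Type _ := WithCStarModule 𝔄 (E × F)

variable {E F G : Type*}
  [NormedAddCommGroup E] [NormedSpace ℂ E] [SMul 𝔄 E] [CStarModule 𝔄 E]
  [NormedAddCommGroup F] [NormedSpace ℂ F] [SMul 𝔄 F] [CStarModule 𝔄 F]
  [NormedAddCommGroup G] [NormedSpace ℂ G] [SMul 𝔄 G] [CStarModule 𝔄 G]

/-- The operator `x ↦ (S x, T x)` from `G` to `E ⊕ F`. -/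
def pairOp (S : G →L[ℂ] E) (T : G →L[ℂ] F) : G →L[ℂ] DSum 𝔄 E F :=
  ((WithCStarModule.equivL ℂ (A := 𝔄) (E := E × F)).symm : E × F →L[ℂ] DSum 𝔄 E F) ∘L S.prod T

/-- The operator on `E ⊕ F` with block matrix `(a b; c d)`. -/
def blockOp (a : E →L[ℂ] E) (b : F →L[ℂ] E) (c : E →L[ℂ] F) (d : F →L[ℂ] F) :
    DSum 𝔄 E F →L[ℂ] DSum 𝔄 E F :=
  pairOp 𝔄 (a.coprod b) (c.coprod d) ∘L
    ((WithCStarModule.equivL ℂ (A := 𝔄) (E := E × F)) : DSum 𝔄 E F →L[ℂ] E × F)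

/-- The operator `S ⊕ T` on `E ⊕ F`. -/
def diagOp (S : E →L[ℂ] E) (T : F →L[ℂ] F) : DSum 𝔄 E F →L[ℂ] DSum 𝔄 E F :=
  blockOp 𝔄 S 0 0 T

end Blocks

section Decomposition

variable {𝔄 H : Type*} [NonUnitalCStarAlgebra 𝔄] [PartialOrder 𝔄] [StarOrderedRing 𝔄]
  [NormedAddCommGroup H] [NormedSpace ℂ H] [SMul 𝔄 H] [CStarModule 𝔄 H]

/-- `H₁ ⊕ H₄ ⊕ H₅ ⊕ H₆`. -/
abbrev Sum₁₄₅₆ (P Q : Adjointable 𝔄 H) : Type _ :=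
  DSum 𝔄 (H₁ P Q).Elem (DSum 𝔄 (H₄ P Q).Elem (DSum 𝔄 (H₅ P Q).Elem (H₆ P Q).Elem))

/-- The operator `x ↦ (P_{H₁} x, P_{H₄} x, P_{H₅} x, P_{H₆} x)`. -/
def decompOp (P Q : Adjointable 𝔄 H) : H →L[ℂ] Sum₁₄₅₆ P Q :=
  pairOp 𝔄 (H₁ P Q).projTo
    (pairOp 𝔄 (H₄ P Q).projTo (pairOp 𝔄 (H₅ P Q).projTo (H₆ P Q).projTo))

/-- The operator `W T W*` on `H₁ ⊕ H₄ ⊕ H₅ ⊕ H₆`, where `W = decompOp P Q`. -/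
def transported (P Q T : Adjointable 𝔄 H) : Sum₁₄₅₆ P Q →L[ℂ] Sum₁₄₅₆ P Q :=
  decompOp P Q ∘L T.toCLM ∘L adj 𝔄 (decompOp P Q)

end Decomposition

end HilbertMod

end

noncomputable section

namespace HilbertMod

/-! ### Idempotents, their range projections and the formula for the matched projection. -/

section CStar

variable {𝓐 : Type*} [CStarAlgebra 𝓐] [PartialOrder 𝓐] [StarOrderedRing 𝓐]

/-! The formula for P = m(Q) matters only through two facts: P is a projection, and with J = 2P - 1
both JQ and -J(1 - Q) are positive (`isMatchedPair_matchedProj`). As JQ is self-adjoint, Q* = JQJ.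
So in block form along 𝓡(P) and 𝓝(P), Q = (a b; c d) with a, d self-adjoint and b = -c*. Positivity
gives a ≥ 1 on 𝓡(P), as well as 𝓡(P) ∩ 𝓝(Q) = 0 = 𝓝(P) ∩ 𝓡(Q).

H₅ and H₆ are the closed ranges of b and c. What remains of 𝓡(P) off H₅ is killed by c, what remains
of 𝓝(P) off H₆ is killed by b, and the two trivial intersections force these remainders to be H₁ and
H₄. Harmony thus yields the orthogonal decomposition (`exists_decomp`).

On H₅ put A = a. Idempotency gives c*c = A(A - 1), whose range is dense in H₅. Hence c has a polar
decomposition c = U D with D = A^{1/2}(A - 1)^{1/2} and U unitary from H₅ to H₆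
(`exists_generic_part`), and Q² = Q then fixes the second column of Q.

The projections are verified rather than derived: y is the component of x in 𝓡(Q) exactly when Qy =
y and Q*(x - y) = 0. On the generic part this reduces to four relations between A, B, D and
B^{1/2}(1 - B)^{1/2} (`mul_inverse_two_mul_sub_one`, `isRangePart_generic`). The null space is the
range of the idempotent 1 - Q and is treated in the same way. -/

theorem isUnit_of_one_le {a : 𝓐} (h : 1 ≤ a) : IsUnit a :=
  CStarAlgebra.isUnit_of_le 1 h (IsStrictlyPositive.iff_of_unital.mpr ⟨zero_le_one, isUnit_one⟩)

/-- An element that absorbs a projection after squaring already absorbs it. -/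
theorem mul_eq_self_of_mul_self_mul {p s : 𝓐} (hp : IsSelfAdjoint p) (hs : IsSelfAdjoint s)
    (h : s * s * p = s * s) : s * p = s := by
  have h0 : star (s * (1 - p)) * (s * (1 - p)) = 0 := by
    simp only [star_mul, star_sub, star_one, hp.star_eq, hs.star_eq]
    linear_combination (norm := noncomm_ring) -(1 - p) * h
  have h1 := CStarRing.star_mul_self_eq_zero_iff _ |>.mp h0
  linear_combination (norm := noncomm_ring) -h1

/-- The range projection `p` of an idempotent. -/
theorem exists_range_projection {Q : 𝓐} (hQ : Q * Q = Q) :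
    ∃ p : 𝓐, IsSelfAdjoint p ∧ p * Q = Q ∧ Q * p = p := by
  -- This k is self-adjoint and invertible, because k² is 1 plus a positive element. Since kQ = Q*Q
  -- = Q*k, the element Q k⁻¹ is the range projection.
  set k := Q + star Q - 1 with hk
  have hQ' : star Q * star Q = star Q := by rw [← star_mul, hQ]
  have hksa : star k = k := by simp [hk, add_comm]
  have hk2 : k * k = 1 + star (star Q - Q) * (star Q - Q) := by
    simp only [hk, star_sub, star_star]
    linear_combination (norm := noncomm_ring) 2 * hQ + 2 * hQ'
  have hku : IsUnit k := by
    have : IsUnit (k * k) := by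
      rw [hk2]
      exact isUnit_of_one_le (le_add_of_nonneg_right (star_mul_self_nonneg _))
    exact ((Commute.refl k).isUnit_mul_iff.mp this).1
  obtain ⟨u, hu⟩ := hku
  have e1 : k * Q = star Q * k := by
    simp only [hk]
    linear_combination (norm := noncomm_ring) hQ - hQ'
  have e2 : Q * (↑u⁻¹ : 𝓐) = ↑u⁻¹ * star Q := by
    rw [← hu] at e1
    rw [Units.eq_inv_mul_iff_mul_eq, ← mul_assoc, e1, Units.mul_inv_cancel_right]
  have hus : star (↑u⁻¹ : 𝓐) = ↑u⁻¹ := by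
    rw [← hu] at hksa
    rw [← Units.coe_star_inv]
    congr 2
    exact Units.ext hksa
  refine ⟨Q * ↑u⁻¹, ?_, ?_, by rw [← mul_assoc, hQ]⟩
  · rw [isSelfAdjoint_iff, star_mul, hus, e2]
  · have e3 : star Q * Q = k * Q := by
      simp only [hk]
      linear_combination (norm := noncomm_ring) -hQ
    rw [e2, mul_assoc, e3, ← hu, Units.inv_mul_cancel_left]

/-- For an idempotent `Q`, `|Q*|` is invertible in the corner of the range projection of `Q`. -/
theorem exists_abs_star_corner_inverse {Q : 𝓐} (hQ : Q * Q = Q) :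
    ∃ p X : 𝓐, IsSelfAdjoint p ∧ p * Q = Q ∧ Q * p = p ∧ p * CFC.abs (star Q) = CFC.abs (star Q) ∧
      CFC.abs (star Q) * X = p ∧ X * CFC.abs (star Q) = p ∧ p * X = X ∧ IsSelfAdjoint X := by
  obtain ⟨p, hp, hpQ, hQp⟩ := exists_range_projection hQ
  set S := CFC.abs (star Q) with hS
  have hSS : S * S = Q * star Q := by rw [hS, CFC.abs_mul_abs, star_star]
  have hSsa : IsSelfAdjoint S := IsSelfAdjoint.of_nonneg (CFC.abs_nonneg _)
  have hQsp : star Q * p = star Q := by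
    have := congrArg star hpQ
    rwa [star_mul, hp.star_eq] at this
  have hpp : p * p = p := by
    nth_rewrite 2 [← hQp]
    rw [← mul_assoc, hpQ, hQp]
  have hSp : S * p = S := mul_eq_self_of_mul_self_mul hp hSsa (by rw [hSS, mul_assoc, hQsp])
  have hpS : p * S = S := by
    have := congrArg star hSp
    rwa [star_mul, hp.star_eq, hSsa.star_eq] at this
  -- V is S on the corner of p and the identity on its complement. Since Q p Q* = p, its square is 1
  -- + Q(1 - p)Q* ≥ 1, so V is invertible and X = p V⁻¹ inverts S in the corner.
  set V := S + 1 - p with hV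
  have hVsa : star V = V := by simp [hV, hp.star_eq, hSsa.star_eq]
  have hpQs : p * star Q = p := by
    have := congrArg star hQp
    rwa [star_mul, hp.star_eq] at this
  have hV2 : V * V = 1 + star ((1 - p) * star Q) * ((1 - p) * star Q) := by
    simp only [hV, star_mul, star_sub, star_one, star_star, hp.star_eq]
    linear_combination (norm := noncomm_ring) hSS - hSp - hpS + hpp + 2 * hQp * star Q + 2 * hpQs
      - Q * hpp * star Q - hQp * star Q - hpQs
  have hVu : IsUnit V := by
    have : IsUnit (V * V) := by
      rw [hV2]
      exact isUnit_of_one_le (le_add_of_nonneg_right (star_mul_self_nonneg _))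
    exact ((Commute.refl V).isUnit_mul_iff.mp this).1
  obtain ⟨u, hu⟩ := hVu
  have hpV : p * V = S := by
    simp only [hV]
    linear_combination (norm := noncomm_ring) hpS - hpp
  have hVp : V * p = S := by
    simp only [hV]
    linear_combination (norm := noncomm_ring) hSp - hpp
  have hcomm : p * (↑u⁻¹ : 𝓐) = ↑u⁻¹ * p := by
    rw [Units.eq_inv_mul_iff_mul_eq, ← mul_assoc, hu, hVp, ← hpV, ← hu, Units.mul_inv_cancel_right]
  have hus : star (↑u⁻¹ : 𝓐) = ↑u⁻¹ := by
    rw [← hu] at hVsa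
    rw [← Units.coe_star_inv]
    congr 2
    exact Units.ext hVsa
  refine ⟨p, p * ↑u⁻¹, hp, hpQ, hQp, hpS, ?_, ?_, by rw [← mul_assoc, hpp], ?_⟩
  · rw [← mul_assoc, hSp, ← hpV, ← hu, Units.mul_inv_cancel_right]
  · rw [hcomm, mul_assoc, hpS, ← hVp, ← hu, Units.inv_mul_cancel_left]
  · rw [isSelfAdjoint_iff, star_mul, hus, hp.star_eq, hcomm]

/-- (S + Q)(S + Q*) = 2S(S + 1) collapses the middle of P², which makes P idempotent. Also (S + Q)Q
= (S + 1)Q and (S + Q)(1 - Q) = S(1 - Q), so one of the factors `I`, `X` cancels in each product.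
The last two products come out as conjugates of `X` and `I`, from which their positivity is visible.
-/
theorem matched_projection_identities {Q p S X I : 𝓐} (hp : IsSelfAdjoint p) (hQp : Q * p = p)
    (hpQ : p * Q = Q) (hSsa : IsSelfAdjoint S) (hSS : S * S = Q * star Q) (hpS : p * S = S)
    (hSX : S * X = p) (hXS : X * S = p) (hpX : p * X = X) (hXsa : IsSelfAdjoint X)
    (hI : (S + 1) * I = 1) (hI' : I * (S + 1) = 1) {P : 𝓐}
    (hP : 2 * P = (S + star Q) * X * I * (S + Q)) :
    IsSelfAdjoint P ∧ P * P = P ∧ (2 * P - 1) * Q = star Q * X * Q ∧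
      (1 - 2 * P) * (1 - Q) = star (1 - Q) * I * (1 - Q) ∧ IsSelfAdjoint I := by
  have h2 : ∀ {a b : 𝓐}, 2 * a = 2 * b → a = b := fun {a b} h => by
    have h' : (2 : ℂ) • a = (2 : ℂ) • b := by rwa [two_smul, two_smul, ← two_mul, ← two_mul]
    exact smul_right_injective 𝓐 (two_ne_zero (α := ℂ)) h'
  have hSp : S * p = S := by
    have := congrArg star hpS
    rwa [star_mul, hp.star_eq, hSsa.star_eq] at this
  have hQsp : star Q * p = star Q := by
    have := congrArg star hpQ
    rwa [star_mul, hp.star_eq] at this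
  have hQQ : Q * Q = Q := by
    nth_rewrite 2 [← hpQ]
    rw [← mul_assoc, hQp, hpQ]
  have hQS : Q * S = S := by rw [← hpS, ← mul_assoc, hQp]
  have hSQ : S * star Q = S := by
    have := congrArg star hQS
    rwa [star_mul, hSsa.star_eq] at this
  have hIsa : star I = I := by
    have := congrArg star hI
    simp only [star_mul, star_add, star_one, hSsa.star_eq] at this
    exact left_inv_eq_right_inv this hI
  have hcomm : ∀ {a : 𝓐}, S * a = a * S → a * I = I * a := fun {a} h => by
    linear_combination (norm := noncomm_ring) -hI' * a * I + I * a * hI + I * h * I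
  have hXI : X * I = I * X := hcomm (hSX.trans hXS.symm)
  have hpI : p * I = I * p := hcomm (hSp.trans hpS.symm)
  have hSI : S * I = I * S := hcomm rfl
  refine ⟨?_, ?_, ?_, ?_, hIsa⟩
  · refine h2 ?_
    have := congrArg star hP
    simp only [star_mul, star_add, star_star, hSsa.star_eq, hXsa.star_eq, hIsa, star_ofNat] at this
    rw [hP]
    have e : (2 : 𝓐) * star P = star P * 2 := by noncomm_ring
    rw [e, this]
    linear_combination (norm := noncomm_ring) -(S + star Q) * hXI * (S + Q)
  · refine h2 (h2 ?_)
    have e : 2 * (2 * (P * P)) = (2 * P) * (2 * P) := by noncomm_ring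
    rw [e, hP]
    have e1 : (S + Q) * (S + star Q) = 2 * S * (S + 1) := by
      linear_combination (norm := noncomm_ring) hSQ + hQS - hSS
    have e2 : X * I * S * (S + 1) * (X * I) = X * I := by
      linear_combination (norm := noncomm_ring) X * I * S * (S + 1) * hXI + X * I * S * hI * X
        - X * hSI * X + hXS * I * X - p * hXI + hpX * I
    linear_combination (norm := noncomm_ring) (S + star Q) * X * I * e1 * X * I * (S + Q)
      + 2 * (S + star Q) * e2 * (S + Q)
  · linear_combination (norm := noncomm_ring) hP * Q + (S + star Q) * X * I * hQQ
      + (S + star Q) * X * hI' * Q + hSX * Q + hpQ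
  · rw [star_sub, star_one]
    linear_combination (norm := noncomm_ring) -hP * (1 - Q) + (S + star Q) * X * I * hQQ
      + (S + star Q) * X * hSI * (1 - Q) - (S + star Q) * hXS * I * (1 - Q)
      - hSp * I * (1 - Q) - hQsp * I * (1 - Q) - hI * (1 - Q)

end CStar

/-! ### Matched pairs and orthogonality in Hilbert modules. -/

section Matched

variable {𝔄 H : Type*} [NonUnitalCStarAlgebra 𝔄] [PartialOrder 𝔄] [StarOrderedRing 𝔄]
  [NormedAddCommGroup H] [NormedSpace ℂ H] [SMul 𝔄 H] [CStarModule 𝔄 H]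

/-- TX and TY are self-adjoint and each absorbs the other, so taking adjoints identifies them; the
same holds for XT and YT. -/
theorem IsMoorePenroseInverse.unique {T X Y : Adjointable 𝔄 H} (hX : IsMoorePenroseInverse T X)
    (hY : IsMoorePenroseInverse T Y) : X = Y := by
  obtain ⟨hX1, hX2, hX3, hX4⟩ := hX
  obtain ⟨hY1, hY2, hY3, hY4⟩ := hY
  have h1 : T * X = T * Y := by
    have h := congrArg star (congrArg (· * X) hY1)
    simp only [mul_assoc] at h
    rw [← mul_assoc, star_mul, hX3, hY3, ← mul_assoc, hX1] at h
    exact h.symm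
  have h2 : X * T = Y * T := by
    have h := congrArg star (congrArg (X * ·) hY1)
    simp only [mul_assoc] at h
    rw [← mul_assoc, star_mul, hX4, hY4, mul_assoc, ← mul_assoc T, hX1] at h
    exact h.symm
  rw [← hX2, h2, mul_assoc, h1, ← mul_assoc, hY2]

theorem IsMoorePenroseInverse.mpInverse_eq {T X : Adjointable 𝔄 H}
    (hX : IsMoorePenroseInverse T X) : mpInverse T = X := by
  have h : ∃ X, IsMoorePenroseInverse T X := ⟨X, hX⟩
  rw [mpInverse, dif_pos h]
  exact h.choose_spec.unique hX

/-- The operator `(x, y) ↦ S x + T y` from `E ⊕ F` to `G`. -/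
def copairOp {E F G : Type*}
    [NormedAddCommGroup E] [NormedSpace ℂ E] [SMul 𝔄 E] [CStarModule 𝔄 E]
    [NormedAddCommGroup F] [NormedSpace ℂ F] [SMul 𝔄 F] [CStarModule 𝔄 F]
    [NormedAddCommGroup G] [NormedSpace ℂ G]
    (S : E →L[ℂ] G) (T : F →L[ℂ] G) : DSum 𝔄 E F →L[ℂ] G :=
  S.coprod T ∘L ((WithCStarModule.equivL ℂ (A := 𝔄) (E := E × F)) : DSum 𝔄 E F →L[ℂ] E × F)

/-- The operator `(x₁, x₄, x₅, x₆) ↦ x₁ + x₄ + x₅ + x₆`. -/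
def sumOp (P Q : Adjointable 𝔄 H) : Sum₁₄₅₆ P Q →L[ℂ] H :=
  copairOp (H₁ P Q).toSubmodule.subtypeL (copairOp (H₄ P Q).toSubmodule.subtypeL
    (copairOp (H₅ P Q).toSubmodule.subtypeL (H₆ P Q).toSubmodule.subtypeL))

theorem sumOp_apply {P Q : Adjointable 𝔄 H} (v : Sum₁₄₅₆ P Q) :
    sumOp P Q v = (v.1 : H) + ((v.2.1 : H) + ((v.2.2.1 : H) + (v.2.2.2 : H))) := rfl

/-- A projection `P` and an idempotent `Q` such that `(2P - I) Q` and `(I - 2P) (I - Q)` are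
positive. -/
structure IsMatchedPair [CompleteSpace H] (P Q : Adjointable 𝔄 H) : Prop where
  isSelfAdjoint : IsSelfAdjoint P
  mul_self : P * P = P
  mul_self' : Q * Q = Q
  nonneg : 0 ≤ (2 * P - 1) * Q
  nonneg' : 0 ≤ (1 - 2 * P) * (1 - Q)

/-- The link with the explicit formula: what follows uses only the matched-pair axioms. Positivity
of X and (S + 1)⁻¹ comes from X = XSX and (S + 1)⁻¹ = (S + 1)⁻¹(S + 1)(S + 1)⁻¹. -/
theorem isMatchedPair_matchedProj [CompleteSpace H] {Q : Adjointable 𝔄 H} (hQ : Q * Q = Q) :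
    IsMatchedPair (matchedProj Q) Q := by
  obtain ⟨p, X, hp, hpQ, hQp, hpS, hSX, hXS, hpX, hXsa⟩ := exists_abs_star_corner_inverse hQ
  set S := CFC.abs (star Q) with hS
  have hS0 : 0 ≤ S := CFC.abs_nonneg _
  have hmp : mpInverse S = X := by
    refine IsMoorePenroseInverse.mpInverse_eq ⟨?_, ?_, ?_, ?_⟩
    · rw [hSX, hpS]
    · rw [hXS, hpX]
    · rw [hSX, hp.star_eq]
    · rw [hXS, hp.star_eq]
  have hu : IsUnit (S + 1) := isUnit_of_one_le (le_add_of_nonneg_left hS0)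
  have h2P : 2 * matchedProj Q = (S + star Q) * X * Ring.inverse (S + 1) * (S + Q) := by
    rw [matchedProj, ← hS, hmp, mul_smul_comm, two_mul, smul_add, ← add_smul]
    norm_num
  obtain ⟨h1, h2, h3, h4, h5⟩ := matched_projection_identities hp hQp hpQ
    (IsSelfAdjoint.of_nonneg hS0) (by rw [hS, CFC.abs_mul_abs, star_star]) hpS hSX hXS hpX hXsa
    (Ring.mul_inverse_cancel _ hu) (Ring.inverse_mul_cancel _ hu) h2P
  have hX0 : 0 ≤ X := by
    have : X = star X * S * X := by rw [hXsa.star_eq, hXS, hpX]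
    rw [this]
    exact star_left_conjugate_nonneg hS0 X
  have hI0 : 0 ≤ Ring.inverse (S + 1) := by
    have : Ring.inverse (S + 1) = star (Ring.inverse (S + 1)) * (S + 1) * Ring.inverse (S + 1) := by
      rw [h5.star_eq, Ring.inverse_mul_cancel _ hu, one_mul]
    rw [this]
    exact star_left_conjugate_nonneg (add_nonneg hS0 zero_le_one) _
  exact ⟨h1, h2, hQ, h3 ▸ star_left_conjugate_nonneg hX0 _, h4 ▸ star_left_conjugate_nonneg hI0 _⟩

theorem Adjointable.toCLM_neg (T : Adjointable 𝔄 H) : (-T).toCLM = -T.toCLM := rfl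

theorem Adjointable.inner_left (T : Adjointable 𝔄 H) (x y : H) :
    ⟪T.toCLM x, y⟫_𝔄 = ⟪x, (star T).toCLM y⟫_𝔄 := T.pair_star x y

theorem Adjointable.inner_right (T : Adjointable 𝔄 H) (x y : H) :
    ⟪x, T.toCLM y⟫_𝔄 = ⟪(star T).toCLM x, y⟫_𝔄 := by
  rw [Adjointable.inner_left, star_star]

theorem Adjointable.inner_nonneg [CompleteSpace H] {T : Adjointable 𝔄 H} (hT : 0 ≤ T) (x : H) :
    0 ≤ ⟪x, T.toCLM x⟫_𝔄 := by
  obtain ⟨R, rfl⟩ := CStarAlgebra.nonneg_iff_eq_star_mul_self.mp hT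
  rw [Adjointable.toCLM_mul, mul_apply_eq_comp, Adjointable.inner_right, star_star]
  exact CStarModule.inner_self_nonneg

theorem eq_zero_of_inner_neg_self_nonneg {x : H} (h : 0 ≤ ⟪x, -x⟫_𝔄) : x = 0 := by
  rw [CStarModule.inner_neg_right, neg_nonneg] at h
  exact CStarModule.inner_self.mp (le_antisymm h CStarModule.inner_self_nonneg)

theorem inner_eq_zero_comm {x y : H} : ⟪x, y⟫_𝔄 = 0 ↔ ⟪y, x⟫_𝔄 = 0 := by
  rw [← CStarModule.star_inner, star_eq_zero]

theorem Sub.closure_induction {M : Sub 𝔄 H} {p : H → Prop} (hc : IsClosed {x | p x})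
    (h : ∀ x ∈ M.toSubmodule, p x) : ∀ x ∈ M.closure.toSubmodule, p x := fun _ hx =>
  closure_minimal (t := {x | p x}) h hc hx

theorem Sub.inner_closure_eq_zero {M : Sub 𝔄 H} {x : H} (h : ∀ w ∈ M.toSubmodule, ⟪x, w⟫_𝔄 = 0) :
    ∀ w ∈ M.closure.toSubmodule, ⟪x, w⟫_𝔄 = 0 :=
  Sub.closure_induction (isClosed_eq
    (CStarModule.continuous_inner.comp (continuous_const.prodMk continuous_id)) continuous_const) h

theorem Sub.le_closure (M : Sub 𝔄 H) {x : H} (hx : x ∈ M.toSubmodule) :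
    x ∈ M.closure.toSubmodule := M.toSubmodule.le_topologicalClosure hx

theorem Sub.projTo_of_mem {M : Sub 𝔄 H} (h : M.IsOrthComplemented) {x : H}
    (hx : x ∈ M.toSubmodule) : (M.projTo x : H) = x :=
  Sub.projTo_eq h hx (z := 0) (by simp) (by simp)

theorem Sub.inner_projTo_left {M : Sub 𝔄 H} (hM : M.IsOrthComplemented) (x : H) (m : M.Elem) :
    ⟪M.projTo x, m⟫_𝔄 = ⟪x, (m : H)⟫_𝔄 := by
  have := M.inner_projTo x m
  rw [Sub.projTo_of_mem hM m.2] at this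
  exact this

end Matched

/-! ### The corners of Q and the decomposition H = H₁ ⊕ H₄ ⊕ H₅ ⊕ H₆. -/

namespace IsMatchedPair

variable {𝔄 H : Type*} [NonUnitalCStarAlgebra 𝔄] [PartialOrder 𝔄] [StarOrderedRing 𝔄]
  [NormedAddCommGroup H] [NormedSpace ℂ H] [SMul 𝔄 H] [CStarModule 𝔄 H] [CompleteSpace H]
  {P Q : Adjointable 𝔄 H}

theorem symm_mul_symm (h : IsMatchedPair P Q) : (2 * P - 1) * (2 * P - 1) = 1 := by
  linear_combination (norm := noncomm_ring) 4 * h.mul_self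

/-- The positive element (2P - 1)Q is self-adjoint, and 2P - 1 is a self-adjoint involution. -/
theorem star_eq (h : IsMatchedPair P Q) : star Q = (2 * P - 1) * Q * (2 * P - 1) := by
  have h1 : star ((2 * P - 1) * Q) = (2 * P - 1) * Q := (IsSelfAdjoint.of_nonneg h.nonneg).star_eq
  have e : star (2 * P - 1) = 2 * P - 1 := by
    simp only [star_sub, star_mul, star_ofNat, star_one, h.isSelfAdjoint.star_eq]
    noncomm_ring
  rw [star_mul, e] at h1
  rw [← h1, mul_assoc, h.symm_mul_symm, mul_one]

/-- Conjugation by 2P - 1 changes the sign of the off-diagonal corners, so taking adjoints swaps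
them with a minus sign. -/
theorem star_off_diag (h : IsMatchedPair P Q) : star ((1 - P) * Q * P) = -(P * Q * (1 - P)) := by
  simp only [star_mul, star_sub, star_one, h.isSelfAdjoint.star_eq, h.star_eq]
  linear_combination (norm := noncomm_ring) 2 * h.mul_self * Q * (2 * P - 1) * (1 - P)
    - P * Q * 2 * h.mul_self

theorem star_off_diag' (h : IsMatchedPair P Q) : star (P * Q * (1 - P)) = -((1 - P) * Q * P) := by
  rw [← star_inj, star_star, star_neg, h.star_off_diag, neg_neg]

theorem apply_apply (h : IsMatchedPair P Q) (x : H) : P.toCLM (P.toCLM x) = P.toCLM x :=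
  congrArg (fun T => T.toCLM x) h.mul_self

theorem apply_apply' (h : IsMatchedPair P Q) (x : H) : Q.toCLM (Q.toCLM x) = Q.toCLM x :=
  congrArg (fun T => T.toCLM x) h.mul_self'

theorem inner_nonneg (h : IsMatchedPair P Q) (x : H) :
    0 ≤ ⟪x, (2 : ℂ) • P.toCLM (Q.toCLM x) - Q.toCLM x⟫_𝔄 := by
  have := Adjointable.inner_nonneg h.nonneg x
  rwa [sub_mul, two_mul, ← two_smul ℂ, one_mul, smul_mul_assoc] at this

theorem inner_nonneg' (h : IsMatchedPair P Q) (x : H) :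
    0 ≤ ⟪x, (x - Q.toCLM x) - (2 : ℂ) • P.toCLM (x - Q.toCLM x)⟫_𝔄 := by
  have := Adjointable.inner_nonneg h.nonneg' x
  rwa [sub_mul, two_mul, ← two_smul ℂ, one_mul, smul_mul_assoc] at this

/-- `𝓝(P) ∩ 𝓡(Q) = 0`. -/
theorem eq_zero_of_ker_of_range (h : IsMatchedPair P Q) {x : H} (h1 : P.toCLM x = 0)
    (h2 : Q.toCLM x = x) : x = 0 := by
  refine eq_zero_of_inner_neg_self_nonneg (𝔄 := 𝔄) ?_
  simpa [h1, h2] using h.inner_nonneg x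

/-- `𝓡(P) ∩ 𝓝(Q) = 0`. -/
theorem eq_zero_of_range_of_ker (h : IsMatchedPair P Q) {x : H} (h1 : P.toCLM x = x)
    (h2 : Q.toCLM x = 0) : x = 0 := by
  refine eq_zero_of_inner_neg_self_nonneg (𝔄 := 𝔄) ?_
  have := h.inner_nonneg' x
  rw [h2, sub_zero, h1, two_smul] at this
  simpa using this

/-- The difference x - Qx lies in 𝓡(P) ∩ 𝓝(Q), which is zero. -/
theorem apply_eq_self (h : IsMatchedPair P Q) {x : H} (h1 : P.toCLM x = x)
    (h2 : P.toCLM (Q.toCLM x) = Q.toCLM x) : Q.toCLM x = x := by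
  refine (sub_eq_zero.mp (h.eq_zero_of_range_of_ker ?_ ?_)).symm
  · rw [map_sub, h1, h2]
  · rw [map_sub, h.apply_apply', sub_self]

theorem apply_eq_zero (h : IsMatchedPair P Q) {x : H}
    (h2 : P.toCLM (Q.toCLM x) = 0) : Q.toCLM x = 0 :=
  h.eq_zero_of_ker_of_range h2 (h.apply_apply' x)

theorem apply_of_mem_H₅ (h : IsMatchedPair P Q) : ∀ x ∈ (H₅ P Q).toSubmodule, P.toCLM x = x := by
  refine Sub.closure_induction (isClosed_eq P.toCLM.continuous continuous_id) ?_
  rintro _ ⟨y, rfl⟩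
  exact h.apply_apply _

theorem apply_of_mem_H₆ (h : IsMatchedPair P Q) : ∀ x ∈ (H₆ P Q).toSubmodule, P.toCLM x = 0 := by
  refine Sub.closure_induction (isClosed_eq P.toCLM.continuous continuous_const) ?_
  rintro _ ⟨y, rfl⟩
  change P.toCLM (Q.toCLM (P.toCLM y) - P.toCLM (Q.toCLM (P.toCLM y))) = 0
  rw [map_sub, h.apply_apply, sub_self]

theorem mem_H₁ {x : H} (h1 : P.toCLM x = x) (h2 : Q.toCLM x = x) :
    x ∈ (H₁ P Q).toSubmodule := ⟨⟨x, h1⟩, ⟨x, h2⟩⟩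

theorem apply_of_mem_H₁ (h : IsMatchedPair P Q) {x : H} (hx : x ∈ (H₁ P Q).toSubmodule) :
    P.toCLM x = x ∧ Q.toCLM x = x := by
  obtain ⟨⟨y, rfl⟩, ⟨z, hz⟩⟩ := hx
  refine ⟨h.apply_apply y, ?_⟩
  rw [← hz]
  exact h.apply_apply' z

theorem apply_of_mem_H₄ {x : H} (hx : x ∈ (H₄ P Q).toSubmodule) :
    P.toCLM x = 0 ∧ Q.toCLM x = 0 := hx

theorem inner_apply (h : IsMatchedPair P Q) (x y : H) :
    ⟪P.toCLM x, y⟫_𝔄 = ⟪x, P.toCLM y⟫_𝔄 := by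
  rw [Adjointable.inner_left, h.isSelfAdjoint.star_eq]

theorem star_apply (h : IsMatchedPair P Q) (x : H) : (star Q).toCLM x =
    (2 : ℂ) • P.toCLM (Q.toCLM ((2 : ℂ) • P.toCLM x - x)) - Q.toCLM ((2 : ℂ) • P.toCLM x - x) := by
  rw [h.star_eq, two_mul, ← two_smul ℂ, sub_mul, one_mul, smul_mul_assoc]
  rfl

theorem star_apply_of_range (h : IsMatchedPair P Q) {x : H} (hx : P.toCLM x = x) :
    (star Q).toCLM x = (2 : ℂ) • P.toCLM (Q.toCLM x) - Q.toCLM x := by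
  rw [h.star_apply, hx, two_smul ℂ x, add_sub_cancel_right]

theorem star_apply_of_ker (h : IsMatchedPair P Q) {x : H} (hx : P.toCLM x = 0) :
    (star Q).toCLM x = Q.toCLM x - (2 : ℂ) • P.toCLM (Q.toCLM x) := by
  rw [h.star_apply, hx, smul_zero, zero_sub, map_neg, map_neg, smul_neg]
  abel

/-- Elements of `𝓡(P)` and `𝓝(P)` are orthogonal. -/
theorem inner_range_ker (h : IsMatchedPair P Q) {x y : H} (hx : P.toCLM x = x)
    (hy : P.toCLM y = 0) : ⟪x, y⟫_𝔄 = 0 := by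
  rw [← hx, h.inner_apply, hy, CStarModule.inner_zero_right]

/-- The adjoint of PQ(1 - P) is -(1 - P)QP, which kills a vector fixed by both P and Q. -/
theorem inner_H₁_H₅ (h : IsMatchedPair P Q) {x : H} (hx : x ∈ (H₁ P Q).toSubmodule) :
    ∀ w ∈ (H₅ P Q).toSubmodule, ⟪x, w⟫_𝔄 = 0 := by
  obtain ⟨h1, h2⟩ := h.apply_of_mem_H₁ hx
  refine Sub.inner_closure_eq_zero ?_
  rintro _ ⟨y, rfl⟩
  change ⟪x, (P * Q * (1 - P)).toCLM y⟫_𝔄 = 0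
  rw [Adjointable.inner_right, h.star_off_diag']
  simp [Adjointable.toCLM_neg, h1, h2]

theorem inner_H₄_H₆ (h : IsMatchedPair P Q) {x : H} (hx : x ∈ (H₄ P Q).toSubmodule) :
    ∀ w ∈ (H₆ P Q).toSubmodule, ⟪x, w⟫_𝔄 = 0 := by
  obtain ⟨h1, h2⟩ := apply_of_mem_H₄ hx
  refine Sub.inner_closure_eq_zero ?_
  rintro _ ⟨y, rfl⟩
  change ⟪x, ((1 - P) * Q * P).toCLM y⟫_𝔄 = 0
  rw [Adjointable.inner_right, h.star_off_diag]
  simp [Adjointable.toCLM_neg, h1, h2]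

/-- With c = (1 - P)QP and b = PQ(1 - P), ⟪cx, cx⟫ = -⟪x, bcx⟫, and bcx lies in H₅. -/
theorem off_diag_eq_zero (h : IsMatchedPair P Q) {x : H}
    (hx : ∀ w ∈ (H₅ P Q).toSubmodule, ⟪x, w⟫_𝔄 = 0) : ((1 - P) * Q * P).toCLM x = 0 := by
  rw [← CStarModule.inner_self (A := 𝔄), Adjointable.inner_left, h.star_off_diag]
  refine (CStarModule.inner_neg_right (A := 𝔄)).trans (neg_eq_zero.mpr ?_)
  exact hx _ (Sub.le_closure _ ⟨_, rfl⟩)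

theorem off_diag_eq_zero' (h : IsMatchedPair P Q) {x : H}
    (hx : ∀ w ∈ (H₆ P Q).toSubmodule, ⟪x, w⟫_𝔄 = 0) : (P * Q * (1 - P)).toCLM x = 0 := by
  rw [← CStarModule.inner_self (A := 𝔄), Adjointable.inner_left, h.star_off_diag']
  refine (CStarModule.inner_neg_right (A := 𝔄)).trans (neg_eq_zero.mpr ?_)
  exact hx _ (Sub.le_closure _ ⟨_, rfl⟩)

/-- Split Px along H₅ and (1 - P)x along H₆. The remainders stay in 𝓡(P) and 𝓝(P) and are killed by
the off-diagonal corners, which puts them in H₁ and H₄. -/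
theorem exists_decomp (h : IsMatchedPair P Q) (hh : IsHarmonious P Q) (x : H) :
    ∃ x₁ ∈ (H₁ P Q).toSubmodule, ∃ x₄ ∈ (H₄ P Q).toSubmodule, ∃ x₅ ∈ (H₅ P Q).toSubmodule,
      ∃ x₆ ∈ (H₆ P Q).toSubmodule, x = x₁ + (x₄ + (x₅ + x₆)) := by
  obtain ⟨x₅, h5, y, hy, e5⟩ := hh.1 (P.toCLM x)
  obtain ⟨x₆, h6, z, hz, e6⟩ := hh.2 (x - P.toCLM x)
  have hPy : P.toCLM y = y := by
    rw [← sub_eq_iff_eq_add'.mpr e5, map_sub, h.apply_apply, h.apply_of_mem_H₅ _ h5]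
  have hPz : P.toCLM z = 0 := by
    rw [← sub_eq_iff_eq_add'.mpr e6, map_sub, map_sub, h.apply_apply, h.apply_of_mem_H₆ _ h6,
      sub_self, sub_zero]
  refine ⟨y, mem_H₁ hPy (h.apply_eq_self hPy ?_), z, ⟨hPz, h.apply_eq_zero ?_⟩, x₅, h5, x₆, h6, ?_⟩
  · have := h.off_diag_eq_zero hy
    simp only [Adjointable.toCLM_mul, Adjointable.toCLM_sub, Adjointable.toCLM_one,
      mul_apply_eq_comp, sub_apply, one_apply_eq_self, hPy] at this
    exact (sub_eq_zero.mp this).symm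
  · have := h.off_diag_eq_zero' hz
    simpa [hPz] using this
  · rw [← add_sub_cancel (P.toCLM x) x, e6, e5]
    abel

theorem orthogonal_H₁ (h : IsMatchedPair P Q) (v : Sum₁₄₅₆ P Q) :
    ∀ w ∈ (H₁ P Q).toSubmodule, ⟪(v.2.1 : H) + ((v.2.2.1 : H) + (v.2.2.2 : H)), w⟫_𝔄 = 0 := by
  intro w hw
  have hw' := (h.apply_of_mem_H₁ hw).1
  rw [inner_eq_zero_comm, CStarModule.inner_add_right, CStarModule.inner_add_right,
    h.inner_range_ker hw' v.2.1.2.1, h.inner_H₁_H₅ hw _ v.2.2.1.2,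
    h.inner_range_ker hw' (h.apply_of_mem_H₆ _ v.2.2.2.2)]
  simp

theorem orthogonal_H₄ (h : IsMatchedPair P Q) (v : Sum₁₄₅₆ P Q) :
    ∀ w ∈ (H₄ P Q).toSubmodule, ⟪(v.1 : H) + ((v.2.2.1 : H) + (v.2.2.2 : H)), w⟫_𝔄 = 0 := by
  intro w hw
  rw [CStarModule.inner_add_left, CStarModule.inner_add_left,
    h.inner_range_ker (h.apply_of_mem_H₁ v.1.2).1 hw.1,
    h.inner_range_ker (h.apply_of_mem_H₅ _ v.2.2.1.2) hw.1,
    inner_eq_zero_comm.mp (h.inner_H₄_H₆ hw _ v.2.2.2.2)]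
  simp

theorem orthogonal_H₅ (h : IsMatchedPair P Q) (v : Sum₁₄₅₆ P Q) :
    ∀ w ∈ (H₅ P Q).toSubmodule, ⟪(v.1 : H) + ((v.2.1 : H) + (v.2.2.2 : H)), w⟫_𝔄 = 0 := by
  intro w hw
  have hw' := h.apply_of_mem_H₅ _ hw
  rw [CStarModule.inner_add_left, CStarModule.inner_add_left, h.inner_H₁_H₅ v.1.2 _ hw,
    inner_eq_zero_comm.mp (h.inner_range_ker hw' v.2.1.2.1),
    inner_eq_zero_comm.mp (h.inner_range_ker hw' (h.apply_of_mem_H₆ _ v.2.2.2.2))]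
  simp

theorem orthogonal_H₆ (h : IsMatchedPair P Q) (v : Sum₁₄₅₆ P Q) :
    ∀ w ∈ (H₆ P Q).toSubmodule, ⟪(v.1 : H) + ((v.2.1 : H) + (v.2.2.1 : H)), w⟫_𝔄 = 0 := by
  intro w hw
  have hw' := h.apply_of_mem_H₆ _ hw
  rw [CStarModule.inner_add_left, CStarModule.inner_add_left, h.inner_H₄_H₆ v.2.1.2 _ hw,
    h.inner_range_ker (h.apply_of_mem_H₁ v.1.2).1 hw',
    h.inner_range_ker (h.apply_of_mem_H₅ _ v.2.2.1.2) hw']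
  simp

theorem exists_sumOp_eq (h : IsMatchedPair P Q) (hh : IsHarmonious P Q) (x : H) :
    ∃ v, x = sumOp P Q v := by
  obtain ⟨x₁, h1, x₄, h4, x₅, h5, x₆, h6, e⟩ := h.exists_decomp hh x
  exact ⟨(⟨x₁, h1⟩, (⟨x₄, h4⟩, (⟨x₅, h5⟩, ⟨x₆, h6⟩))), e⟩

theorem isOrthComplemented_H₁ (h : IsMatchedPair P Q) (hh : IsHarmonious P Q) :
    (H₁ P Q).IsOrthComplemented := fun x => by
  obtain ⟨v, rfl⟩ := h.exists_sumOp_eq hh x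
  exact ⟨_, v.1.2, _, h.orthogonal_H₁ v, sumOp_apply v⟩

theorem isOrthComplemented_H₄ (h : IsMatchedPair P Q) (hh : IsHarmonious P Q) :
    (H₄ P Q).IsOrthComplemented := fun x => by
  obtain ⟨v, rfl⟩ := h.exists_sumOp_eq hh x
  exact ⟨_, v.2.1.2, _, h.orthogonal_H₄ v, by rw [sumOp_apply]; abel⟩

theorem isAdjointPair_decompOp (h : IsMatchedPair P Q) (hh : IsHarmonious P Q) :
    IsAdjointPair 𝔄 (decompOp P Q) (sumOp P Q) := fun x v => by
  rw [sumOp_apply, CStarModule.inner_add_right, CStarModule.inner_add_right,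
    CStarModule.inner_add_right, ← Sub.inner_projTo_left (h.isOrthComplemented_H₁ hh),
    ← Sub.inner_projTo_left (h.isOrthComplemented_H₄ hh), ← Sub.inner_projTo_left hh.1, ← Sub.inner_projTo_left hh.2]
  rfl

theorem decompOp_sumOp (h : IsMatchedPair P Q) (hh : IsHarmonious P Q) (v : Sum₁₄₅₆ P Q) :
    decompOp P Q (sumOp P Q v) = v := by
  have e1 : (H₁ P Q).projTo (sumOp P Q v) = v.1 := Subtype.ext <|
    Sub.projTo_eq (h.isOrthComplemented_H₁ hh) v.1.2 (h.orthogonal_H₁ v) (sumOp_apply v)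
  have e4 : (H₄ P Q).projTo (sumOp P Q v) = v.2.1 := Subtype.ext <|
    Sub.projTo_eq (h.isOrthComplemented_H₄ hh) v.2.1.2 (h.orthogonal_H₄ v)
      (by rw [sumOp_apply]; abel)
  have e5 : (H₅ P Q).projTo (sumOp P Q v) = v.2.2.1 := Subtype.ext <|
    Sub.projTo_eq hh.1 v.2.2.1.2 (h.orthogonal_H₅ v) (by rw [sumOp_apply]; abel)
  have e6 : (H₆ P Q).projTo (sumOp P Q v) = v.2.2.2 := Subtype.ext <|
    Sub.projTo_eq hh.2 v.2.2.2.2 (h.orthogonal_H₆ v) (by rw [sumOp_apply]; abel)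
  exact Prod.ext e1 (Prod.ext e4 (Prod.ext e5 e6))

theorem sumOp_decompOp (h : IsMatchedPair P Q) (hh : IsHarmonious P Q) (x : H) :
    sumOp P Q (decompOp P Q x) = x := by
  obtain ⟨v, rfl⟩ := h.exists_sumOp_eq hh x
  rw [h.decompOp_sumOp hh]

theorem isUnitaryOp_decompOp (h : IsMatchedPair P Q) (hh : IsHarmonious P Q) :
    IsUnitaryOp 𝔄 (decompOp P Q) := by
  have hadj := h.isAdjointPair_decompOp hh
  refine ⟨⟨_, hadj⟩, ?_, ?_⟩
  · rw [hadj.adj_eq]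
    exact ContinuousLinearMap.ext (h.sumOp_decompOp hh)
  · rw [hadj.adj_eq]
    exact ContinuousLinearMap.ext (h.decompOp_sumOp hh)

/-- Since W* is `sumOp`, the identity WTW* = M becomes TW* = W*M, which can be tested on each
summand without computing any projection. -/
theorem transported_eq (h : IsMatchedPair P Q) (hh : IsHarmonious P Q) {T : Adjointable 𝔄 H}
    {M : Sum₁₄₅₆ P Q →L[ℂ] Sum₁₄₅₆ P Q}
    (hM : ∀ v, T.toCLM (sumOp P Q v) = sumOp P Q (M v)) : transported P Q T = M := by
  rw [transported, (h.isAdjointPair_decompOp hh).adj_eq]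
  refine ContinuousLinearMap.ext fun v => ?_
  change decompOp P Q (T.toCLM (sumOp P Q v)) = M v
  rw [hM, h.decompOp_sumOp hh]

end IsMatchedPair

/-! ### Products of square roots, and approximation of T by multiples of TT*. -/

section CStar

variable {𝓐 : Type*} [CStarAlgebra 𝓐] [PartialOrder 𝓐] [StarOrderedRing 𝓐]

theorem commute_sqrt_left {a b : 𝓐} (h : Commute a b) : Commute (CFC.sqrt a) b := by
  rw [CFC.sqrt_eq_cfc]
  exact h.cfc_nnreal _

theorem sqrt_mul_sqrt_nonneg {a b : 𝓐} (h : Commute a b) : 0 ≤ CFC.sqrt a * CFC.sqrt b :=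
  Commute.mul_nonneg (CFC.sqrt_nonneg a) (CFC.sqrt_nonneg b)
    (commute_sqrt_left (commute_sqrt_left h.symm).symm)

theorem sqrt_mul_sqrt_mul_self {a b : 𝓐} (ha : 0 ≤ a) (hb : 0 ≤ b) (h : Commute a b) :
    CFC.sqrt a * CFC.sqrt b * (CFC.sqrt a * CFC.sqrt b) = a * b := by
  have hc : Commute (CFC.sqrt a) (CFC.sqrt b) :=
    commute_sqrt_left (commute_sqrt_left h.symm).symm
  rw [hc.symm.mul_mul_mul_comm, CFC.sqrt_mul_sqrt_self a ha, CFC.sqrt_mul_sqrt_self b hb]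

/-- Uniqueness of positive square roots: a product of roots can be recognised from its square alone.
-/
theorem sqrt_mul_sqrt_eq {a b c : 𝓐} (ha : 0 ≤ a) (hb : 0 ≤ b) (h : Commute a b) (hc : 0 ≤ c)
    (e : c * c = a * b) : CFC.sqrt a * CFC.sqrt b = c := by
  rw [← CFC.sqrt_unique e hc,
    CFC.sqrt_unique (sqrt_mul_sqrt_mul_self ha hb h) (sqrt_mul_sqrt_nonneg h)]

/-- Let h = TT* and r = (1 + nh)⁻¹. For G = n r T the error T - hG equals rT, with ‖rT‖² = ‖rhr‖.
The identity r = r² + n rhr bounds n‖rhr‖ by ‖r‖ ≤ 1. -/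
theorem exists_norm_sub_mul_star_mul_le (T : 𝓐) (n : ℕ) :
    ∃ G : 𝓐, n * ‖T - T * star T * G‖ ^ 2 ≤ 1 := by
  set h := T * star T with hh
  have h0 : 0 ≤ h := mul_star_self_nonneg T
  have h1 : 1 ≤ 1 + n • h := le_add_of_nonneg_right (nsmul_nonneg h0 n)
  have hu := isUnit_of_one_le h1
  set r := Ring.inverse (1 + n • h) with hr
  have hr1 : (1 + n • h) * r = 1 := Ring.mul_inverse_cancel _ hu
  have hr2 : r * (1 + n • h) = 1 := Ring.inverse_mul_cancel _ hu
  have hrs : star r = r := by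
    have hs : star (1 + n • h) = 1 + n • h :=
      (IsSelfAdjoint.of_nonneg (zero_le_one.trans h1)).star_eq
    have := congrArg star hr1
    rw [star_mul, hs, star_one] at this
    exact left_inv_eq_right_inv this hr1
  have e0 : r = r * 1 * r + n • (r * h * r) := by
    have : r * (1 + n • h) * r = r := by rw [hr2, one_mul]
    nth_rewrite 1 [← this]
    rw [mul_add, add_mul, mul_smul_comm, smul_mul_assoc]
  have hrhr : 0 ≤ r * h * r := by
    have := star_left_conjugate_nonneg h0 r
    rwa [hrs] at this
  have hrr : 0 ≤ r * 1 * r := by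
    have := star_left_conjugate_nonneg (zero_le_one (α := 𝓐)) r
    rwa [hrs] at this
  have n1 : ‖r * 1 * r‖ ≤ ‖r‖ := by
    refine CStarAlgebra.norm_le_norm_of_nonneg_of_le hrr ?_
    nth_rewrite 3 [e0]
    exact le_add_of_nonneg_right (nsmul_nonneg hrhr n)
  have n2 : ‖n • (r * h * r)‖ ≤ ‖r‖ := by
    refine CStarAlgebra.norm_le_norm_of_nonneg_of_le (nsmul_nonneg hrhr n) ?_
    nth_rewrite 3 [e0]
    exact le_add_of_nonneg_left hrr
  -- From r² ≤ r one gets ‖r‖² ≤ ‖r‖.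
  have n3 : ‖r‖ ≤ 1 := by
    rw [mul_one] at n1
    nth_rewrite 1 [← hrs] at n1
    rw [CStarRing.norm_star_mul_self] at n1
    by_contra! hlt
    nlinarith
  refine ⟨n • (r * T), ?_⟩
  have e1 : T - h * n • (r * T) = r * T := by
    have : T = (1 + n • h) * r * T := by rw [hr1, one_mul]
    nth_rewrite 1 [this]
    rw [add_mul, add_mul, one_mul, mul_smul_comm, smul_mul_assoc, smul_mul_assoc, mul_assoc h]
    abel
  have e2 : ‖r * T‖ ^ 2 = ‖r * h * r‖ := by
    rw [sq, ← CStarRing.norm_self_mul_star, star_mul, hrs, hh]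
    congr 1
    noncomm_ring
  rw [e1, e2]
  rw [← Nat.cast_smul_eq_nsmul ℝ, norm_smul, Real.norm_natCast] at n2
  exact n2.trans n3

end CStar

/-! ### Dense ranges, extension to unitaries, and compressions to submodules. -/

section Modules

variable {𝔄 H : Type*} [NonUnitalCStarAlgebra 𝔄] [PartialOrder 𝔄] [StarOrderedRing 𝔄]
  [NormedAddCommGroup H] [NormedSpace ℂ H] [SMul 𝔄 H] [CStarModule 𝔄 H]

/-- The range of `T T*` is dense in the range of `T`. -/
theorem Adjointable.apply_mem_closure_range_mul_star [CompleteSpace H] (T : Adjointable 𝔄 H)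
    (x : H) : T.toCLM x ∈ closure (Set.range (T * star T).toCLM) := by
  rw [Metric.mem_closure_iff]
  intro ε hε
  -- The error on x is at most ‖x‖/√n, which this n makes smaller than ε.
  obtain ⟨n, hn⟩ := exists_nat_gt ((‖x‖ / ε) ^ 2)
  obtain ⟨G, hG⟩ := exists_norm_sub_mul_star_mul_le T n
  refine ⟨_, ⟨G.toCLM x, rfl⟩, ?_⟩
  rw [dist_eq_norm]
  have h1 : ‖T.toCLM x - (T * star T).toCLM (G.toCLM x)‖ ≤ ‖T - T * star T * G‖ * ‖x‖ :=
    (T - T * star T * G).toCLM.le_opNorm x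
  refine h1.trans_lt ?_
  rw [div_pow, div_lt_iff₀ (by positivity)] at hn
  refine lt_of_pow_lt_pow_left₀ 2 hε.le ?_
  rw [mul_pow]
  have h0 : 0 ≤ ‖T - T * star T * G‖ ^ 2 := by positivity
  rcases h0.eq_or_lt with h | h
  · rw [← h, zero_mul]
    positivity
  · calc _ < ‖T - T * star T * G‖ ^ 2 * (n * ε ^ 2) := by gcongr
      _ = n * ‖T - T * star T * G‖ ^ 2 * ε ^ 2 := by ring
      _ ≤ 1 * ε ^ 2 := by gcongr
      _ = _ := one_mul _

/-- Two maps with dense range and the same Gram form differ by a unitary operator. -/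
theorem exists_unitary_of_inner_eq {E F K : Type*} [AddCommGroup E] [Module ℂ E]
    [NormedAddCommGroup F] [NormedSpace ℂ F] [SMul 𝔄 F] [CStarModule 𝔄 F] [CompleteSpace F]
    [NormedAddCommGroup K] [NormedSpace ℂ K] [SMul 𝔄 K] [CStarModule 𝔄 K] [CompleteSpace K]
    {D : E →ₗ[ℂ] K} {C : E →ₗ[ℂ] F} (hD : DenseRange D) (hC : DenseRange C)
    (h : ∀ x y, ⟪C x, C y⟫_𝔄 = ⟪D x, D y⟫_𝔄) :
    ∃ U : K →L[ℂ] F, IsUnitaryOp 𝔄 U ∧ ∀ x, U (D x) = C x := by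
  have hn : ∀ x, ‖C x‖ = ‖D x‖ := fun x => by
    rw [CStarModule.norm_eq_sqrt_norm_inner_self (A := 𝔄), h,
      ← CStarModule.norm_eq_sqrt_norm_inner_self]
  have hb : ∃ c : ℝ, ∀ x, ‖C x‖ ≤ c * ‖D x‖ := ⟨1, fun x => by rw [hn, one_mul]⟩
  -- Equal Gram forms make Dx ↦ Cx well defined and isometric on a dense subspace; U is its
  -- continuous extension.
  set U := C.extendOfNorm D with hU
  have hUD : ∀ x, U (D x) = C x := LinearMap.extendOfNorm_eq hD hb
  have hin : ∀ x y, ⟪U x, U y⟫_𝔄 = ⟪x, y⟫_𝔄 := by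
    intro x y
    refine hD.induction_on₂ (p := fun x y => ⟪U x, U y⟫_𝔄 = ⟪x, y⟫_𝔄) ?_ ?_ x y
    · exact isClosed_eq (CStarModule.continuous_inner.comp
        ((U.continuous.comp continuous_fst).prodMk (U.continuous.comp continuous_snd)))
        CStarModule.continuous_inner
    · intro a b
      rw [hUD, hUD, h]
  have hUn : ∀ x, ‖U x‖ = ‖x‖ := fun x => by
    rw [CStarModule.norm_eq_sqrt_norm_inner_self (A := 𝔄), hin,
      ← CStarModule.norm_eq_sqrt_norm_inner_self]
  let V : K →ₗᵢ[ℂ] F := ⟨U.toLinearMap, hUn⟩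
  -- The range of an isometry on a complete space is closed, and it contains the dense range of `C`.
  have hsurj : Function.Surjective V := by
    rw [← Set.range_eq_univ, ← V.isometry.isClosedEmbedding.isClosed_range.closure_eq]
    refine Set.eq_univ_of_univ_subset (hC.closure_range ▸ closure_mono ?_)
    rintro _ ⟨x, rfl⟩
    exact ⟨D x, hUD x⟩
  let W := LinearIsometryEquiv.ofSurjective V hsurj
  have h1 : ∀ x, U (W.symm x) = x := W.apply_symm_apply
  have h2 : ∀ x, W.symm (U x) = x := W.symm_apply_apply
  have hadj : IsAdjointPair 𝔄 U (W.symm : F →L[ℂ] K) := fun x y => by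
    nth_rewrite 1 [← h1 y]
    exact hin _ _
  refine ⟨U, ⟨⟨_, hadj⟩, ?_, ?_⟩, hUD⟩
  · rw [hadj.adj_eq]
    exact ContinuousLinearMap.ext h2
  · rw [hadj.adj_eq]
    exact ContinuousLinearMap.ext h1

theorem Sub.inner_projTo_right {M : Sub 𝔄 H} (hM : M.IsOrthComplemented) (m : M.Elem) (x : H) :
    ⟪m, M.projTo x⟫_𝔄 = ⟪(m : H), x⟫_𝔄 := by
  rw [← CStarModule.star_inner, Sub.inner_projTo_left hM, CStarModule.star_inner]

/-- The compression of `T ∈ 𝓛(H)` to an orthogonally complemented submodule. -/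
def Sub.compress {M : Sub 𝔄 H} (hM : M.IsOrthComplemented) (T : Adjointable 𝔄 H) :
    Adjointable 𝔄 M.Elem :=
  ⟨M.projTo ∘L T.toCLM ∘L M.toSubmodule.subtypeL,
    M.projTo ∘L (star T).toCLM ∘L M.toSubmodule.subtypeL, fun x y => by
      change ⟪M.projTo (T.toCLM (x : H)), y⟫_𝔄 = ⟪x, M.projTo ((star T).toCLM (y : H))⟫_𝔄
      rw [Sub.inner_projTo_left hM, Sub.inner_projTo_right hM, Adjointable.inner_left]⟩

theorem Sub.compress_apply {M : Sub 𝔄 H} (hM : M.IsOrthComplemented) (T : Adjointable 𝔄 H)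
    (x : M.Elem) : (Sub.compress hM T).toCLM x = M.projTo (T.toCLM (x : H)) := rfl

theorem Sub.star_compress {M : Sub 𝔄 H} (hM : M.IsOrthComplemented) (T : Adjointable 𝔄 H) :
    star (Sub.compress hM T) = Sub.compress hM (star T) :=
  Adjointable.star_eq fun x y => by
    rw [Sub.compress_apply, Sub.compress_apply, Sub.inner_projTo_left hM,
      Sub.inner_projTo_right hM, Adjointable.inner_left]

theorem Sub.isSelfAdjoint_proj (M : Sub 𝔄 H) : IsSelfAdjoint M.proj :=
  Adjointable.star_eq M.inner_projTo

theorem Sub.proj_apply (M : Sub 𝔄 H) (x : H) : M.proj.toCLM x = (M.projTo x : H) := rfl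

theorem Sub.projTo_projTo {M : Sub 𝔄 H} (hM : M.IsOrthComplemented) (x : H) :
    M.projTo (M.projTo x : H) = M.projTo x :=
  Subtype.ext (Sub.projTo_of_mem hM (M.projTo x).2)

/-- Compression is not multiplicative in general. The root R of eTe, with e the projection onto M,
absorbs e on both sides, so its compression is a self-adjoint square root of the compression of T.
-/
theorem Sub.compress_nonneg [CompleteSpace H] {M : Sub 𝔄 H} [CompleteSpace M.Elem]
    (hM : M.IsOrthComplemented) {T : Adjointable 𝔄 H} (hT : 0 ≤ T) :
    0 ≤ Sub.compress hM T := by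
  have hee : M.proj * M.proj = M.proj :=
    Adjointable.ext (ContinuousLinearMap.ext fun x =>
      congrArg Subtype.val (Sub.projTo_projTo hM x))
  have hes := M.isSelfAdjoint_proj
  have hT' : 0 ≤ M.proj * T * M.proj := by
    have := star_left_conjugate_nonneg hT M.proj
    rwa [hes.star_eq] at this
  set R := CFC.sqrt (M.proj * T * M.proj) with hR
  have hRs : IsSelfAdjoint R := IsSelfAdjoint.of_nonneg (CFC.sqrt_nonneg _)
  have hRR : R * R = M.proj * T * M.proj := CFC.sqrt_mul_sqrt_self _ hT'
  have hRe : R * M.proj = R :=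
    mul_eq_self_of_mul_self_mul hes hRs (by rw [hRR, mul_assoc, hee])
  have heR : M.proj * R = R := by
    have := congrArg star hRe
    rwa [star_mul, hes.star_eq, hRs.star_eq] at this
  have : Sub.compress hM T = star (Sub.compress hM R) * Sub.compress hM R := by
    rw [Sub.star_compress, hRs.star_eq]
    refine Adjointable.ext (ContinuousLinearMap.ext fun x => ?_)
    change M.projTo (T.toCLM (x : H)) = M.projTo (R.toCLM ((M.proj * R).toCLM (x : H)))
    rw [heR]
    change _ = M.projTo ((R * R).toCLM (x : H))
    rw [hRR]
    change _ = M.projTo ((M.projTo (T.toCLM (M.projTo (x : H) : H)) : H))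
    rw [Sub.projTo_projTo hM, Sub.projTo_of_mem hM x.2]
  rw [this]
  exact star_mul_self_nonneg _

end Modules

/-! ### The generic part of Q on H₅ ⊕ H₆. -/

namespace IsMatchedPair

variable {𝔄 H : Type*} [NonUnitalCStarAlgebra 𝔄] [PartialOrder 𝔄] [StarOrderedRing 𝔄]
  [NormedAddCommGroup H] [NormedSpace ℂ H] [SMul 𝔄 H] [CStarModule 𝔄 H] [CompleteSpace H]
  {P Q : Adjointable 𝔄 H}

/-- Conjugating (1 - 2P)(1 - Q) ≥ 0 by P gives P(Q - 1)P ≥ 0, whose compression to H₅ ⊆ 𝓡(P) is A -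
1. -/
theorem one_le_compress (h : IsMatchedPair P Q) (hh : IsHarmonious P Q) :
    1 ≤ Sub.compress hh.1 Q := by
  have h1 : 0 ≤ P * (Q - 1) * P := by
    have := star_left_conjugate_nonneg h.nonneg' P
    rw [h.isSelfAdjoint.star_eq] at this
    refine this.trans_eq ?_
    linear_combination (norm := noncomm_ring) -2 * h.mul_self * (1 - Q) * P
  have e : Sub.compress hh.1 Q - 1 = Sub.compress hh.1 (P * (Q - 1) * P) := by
    refine Adjointable.ext (ContinuousLinearMap.ext fun z => ?_)
    refine ext_inner (𝔄 := 𝔄) fun w => ?_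
    change ⟪w, (H₅ P Q).projTo (Q.toCLM (z : H)) - z⟫_𝔄 =
      ⟪w, (H₅ P Q).projTo (P.toCLM (Q.toCLM (P.toCLM (z : H)) - P.toCLM (z : H)))⟫_𝔄
    rw [CStarModule.inner_sub_right, Sub.inner_projTo_right hh.1, Sub.inner_projTo_right hh.1,
      ← h.inner_apply, h.apply_of_mem_H₅ _ z.2, h.apply_of_mem_H₅ _ w.2,
      CStarModule.inner_sub_right]
    rfl
  rw [← sub_nonneg, e]
  exact Sub.compress_nonneg hh.1 h1

theorem mem_H₅ (h : IsMatchedPair P Q) :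
    ∀ x ∈ (H₅ P Q).toSubmodule, P.toCLM (Q.toCLM x) ∈ (H₅ P Q).toSubmodule := by
  refine Sub.closure_induction (IsClosed.preimage
    (P.toCLM.continuous.comp Q.toCLM.continuous) 
    (P * Q * (1 - P)).range.toSubmodule.isClosed_topologicalClosure) ?_
  rintro _ ⟨y, rfl⟩
  -- The witness comes from the corner relation ab = b(1 - d), one entry of Q² = Q.
  refine Sub.le_closure _ ⟨(1 - Q * (1 - P)).toCLM y, ?_⟩
  change (P * Q * (1 - P) * (1 - Q * (1 - P))).toCLM y = (P * Q * (P * Q * (1 - P))).toCLM y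
  congr 2
  linear_combination (norm := noncomm_ring) -P * h.mul_self' * (1 - P)

/-- H₅ is invariant under PQ, so the compression of Q is a plain restriction of PQ. -/
theorem compress_apply (h : IsMatchedPair P Q) (hh : IsHarmonious P Q) (z : (H₅ P Q).Elem) :
    ((Sub.compress hh.1 Q).toCLM z : H) = P.toCLM (Q.toCLM z) := by
  have e : Sub.compress hh.1 Q = Sub.compress hh.1 (P * Q) := by
    refine Adjointable.ext (ContinuousLinearMap.ext fun z => ?_)
    refine ext_inner (𝔄 := 𝔄) fun w => ?_
    change ⟪w, (H₅ P Q).projTo (Q.toCLM (z : H))⟫_𝔄 =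
      ⟪w, (H₅ P Q).projTo (P.toCLM (Q.toCLM (z : H)))⟫_𝔄
    rw [Sub.inner_projTo_right hh.1, Sub.inner_projTo_right hh.1,
      ← h.inner_apply, h.apply_of_mem_H₅ _ w.2]
  rw [e]
  exact Sub.projTo_of_mem hh.1 (h.mem_H₅ z z.2)

/-- The restriction of `(I - P) Q` to a map from `H₅` to `H₆`. -/
def offDiag (P Q : Adjointable 𝔄 H) : (H₅ P Q).Elem →ₗ[ℂ] (H₆ P Q).Elem where
  toFun z := ⟨((1 - P) * Q * P).toCLM z, Sub.le_closure _ ⟨_, rfl⟩⟩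
  map_add' _ _ := Subtype.ext (map_add _ _ _)
  map_smul' _ _ := Subtype.ext (map_smul _ _ _)

theorem offDiag_apply (h : IsMatchedPair P Q) (z : (H₅ P Q).Elem) :
    (offDiag P Q z : H) = Q.toCLM z - P.toCLM (Q.toCLM z) := by
  change Q.toCLM (P.toCLM (z : H)) - P.toCLM (Q.toCLM (P.toCLM (z : H))) = _
  rw [h.apply_of_mem_H₅ _ z.2]

/-- The corner vanishes on the orthogonal complement of H₅, so restricting it to H₅ loses nothing of
its range. -/
theorem offDiag_projTo (h : IsMatchedPair P Q) (hh : IsHarmonious P Q) (x : H) :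
    ((offDiag P Q) ((H₅ P Q).projTo x) : H) = ((1 - P) * Q * P).toCLM x := by
  obtain ⟨y, hy, z, hz, rfl⟩ := hh.1 x
  change ((1 - P) * Q * P).toCLM ((H₅ P Q).projTo (y + z) : H) = _
  rw [Sub.projTo_eq hh.1 hy hz rfl, map_add, h.off_diag_eq_zero hz, add_zero]

theorem denseRange_offDiag (h : IsMatchedPair P Q) (hh : IsHarmonious P Q) :
    DenseRange (offDiag P Q) := by
  refine Subtype.dense_iff.mpr fun x hx => ?_
  refine closure_mono ?_ hx
  rintro _ ⟨y, rfl⟩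
  exact ⟨_, ⟨_, rfl⟩, h.offDiag_projTo hh y⟩

/-- This is c*c = A² - A, the upper-left entry of Q² = Q combined with b = -c*. -/
theorem star_off_diag_apply (h : IsMatchedPair P Q) (hh : IsHarmonious P Q) {A : Adjointable 𝔄
    (H₅ P Q).Elem} (hA : A = Sub.compress hh.1 Q) (z : (H₅ P Q).Elem) :
    (star ((1 - P) * Q * P)).toCLM (offDiag P Q z) = ((A * (A - 1)).toCLM z : H) := by
  have hA' : ∀ z, (A.toCLM z : H) = P.toCLM (Q.toCLM z) := fun z => hA ▸ h.compress_apply hh z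
  rw [h.star_off_diag, h.offDiag_apply]
  change -(P.toCLM (Q.toCLM ((Q.toCLM z - P.toCLM (Q.toCLM z)) -
    P.toCLM (Q.toCLM z - P.toCLM (Q.toCLM z))))) = (A.toCLM (A.toCLM z - z) : H)
  simp only [map_sub, h.apply_apply, h.apply_apply', hA', Submodule.coe_sub, sub_self, sub_zero]
  abel

/-- For T = c*, the range of TT* = c*c = A(A - 1) is dense in the range of T, which is that of b and
hence dense in H₅. -/
theorem denseRange_mul_sub_one (h : IsMatchedPair P Q) (hh : IsHarmonious P Q) {A : Adjointable 𝔄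
    (H₅ P Q).Elem} (hA : A = Sub.compress hh.1 Q) : DenseRange (A * (A - 1)).toCLM := by
  refine Subtype.dense_iff.mpr fun x hx => ?_
  refine closure_minimal ?_ isClosed_closure hx
  rintro _ ⟨y, rfl⟩
  have h1 := Adjointable.apply_mem_closure_range_mul_star (star ((1 - P) * Q * P)) (-y)
  rw [star_star] at h1
  have e : (star ((1 - P) * Q * P)).toCLM (-y) = (P * Q * (1 - P)).toCLM y := by
    rw [h.star_off_diag, map_neg, Adjointable.toCLM_neg, neg_apply, neg_neg]
  rw [e] at h1
  refine closure_mono ?_ h1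
  rintro _ ⟨u, rfl⟩
  refine ⟨_, ⟨(H₅ P Q).projTo u, rfl⟩, ?_⟩
  rw [← h.star_off_diag_apply hh hA, h.offDiag_projTo hh]
  rfl

/-- The generic part of `Q` is determined by a positive operator `A` on `H₅` and a unitary operator
`U` from `H₅` to `H₆`. -/
theorem exists_generic_part (h : IsMatchedPair P Q) (hh : IsHarmonious P Q) :
    ∃ (A : Adjointable 𝔄 (H₅ P Q).Elem) (U : (H₅ P Q).Elem →L[ℂ] (H₆ P Q).Elem),
      1 ≤ A ∧ (A - 1).range.closure.toSubmodule = ⊤ ∧ IsUnitaryOp 𝔄 U ∧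
      (∀ z : (H₅ P Q).Elem, Q.toCLM z = A.toCLM z + U ((CFC.sqrt A * CFC.sqrt (A - 1)).toCLM z)) ∧
      ∀ z : (H₅ P Q).Elem, Q.toCLM (U z) =
        -((CFC.sqrt A * CFC.sqrt (A - 1)).toCLM z : H) + U ((1 - A).toCLM z) := by
  obtain ⟨A, hA⟩ : ∃ A, A = Sub.compress hh.1 Q := ⟨_, rfl⟩
  have h1 : 1 ≤ A := hA ▸ h.one_le_compress hh
  have hA0 : 0 ≤ A := zero_le_one.trans h1
  have hA1 : 0 ≤ A - 1 := sub_nonneg.mpr h1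
  have hA' : ∀ z, (A.toCLM z : H) = P.toCLM (Q.toCLM z) := fun z => hA ▸ h.compress_apply hh z
  have hcomm : Commute A (A - 1) := (Commute.refl A).sub_right (Commute.one_right A)
  obtain ⟨D, hD⟩ : ∃ D, D = CFC.sqrt A * CFC.sqrt (A - 1) := ⟨_, rfl⟩
  have hDD : D * D = A * (A - 1) := hD ▸ sqrt_mul_sqrt_mul_self hA0 hA1 hcomm
  have hD0 : 0 ≤ D := hD ▸ sqrt_mul_sqrt_nonneg hcomm
  have hAD : A * D = D * A := by
    rw [hD]
    exact ((commute_sqrt_left (Commute.refl A)).mul_left (commute_sqrt_left hcomm.symm)).symm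
  have hdense := h.denseRange_mul_sub_one hh hA
  have hDdense : DenseRange D.toCLM := by
    refine hdense.mono ?_
    rw [← hDD]
    rintro _ ⟨x, rfl⟩
    exact ⟨D.toCLM x, rfl⟩
  -- Both forms equal ⟪x, A(A - 1)y⟫, so the resulting U is the polar factor of the corner c.
  have hgram : ∀ x y, ⟪offDiag P Q x, offDiag P Q y⟫_𝔄 = ⟪D.toCLM x, D.toCLM y⟫_𝔄 := fun x y => by
    rw [Adjointable.inner_left, (IsSelfAdjoint.of_nonneg hD0).star_eq]
    change ⟪((1 - P) * Q * P).toCLM x, (offDiag P Q y : H)⟫_𝔄 = ⟪x, (D * D).toCLM y⟫_𝔄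
    rw [Adjointable.inner_left, h.star_off_diag_apply hh hA, hDD]
    rfl
  obtain ⟨U, hU, hUD⟩ := exists_unitary_of_inner_eq (D := D.toCLM.toLinearMap) hDdense
    (h.denseRange_offDiag hh) hgram
  have hQ : ∀ z : (H₅ P Q).Elem, Q.toCLM z = A.toCLM z + U (D.toCLM z) := fun z => by
    rw [hA']
    refine (add_sub_cancel (P.toCLM (Q.toCLM z)) _).symm.trans (congrArg _ ?_)
    rw [← h.offDiag_apply]
    exact congrArg _ (hUD z).symm
  refine ⟨A, U, h1, ?_, hU, hD ▸ hQ, ?_⟩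
  · have : DenseRange (A - 1).toCLM := by
      refine hdense.mono ?_
      rw [hcomm.eq]
      rintro _ ⟨x, rfl⟩
      exact ⟨A.toCLM x, rfl⟩
    exact (Submodule.dense_iff_topologicalClosure_eq_top (s := (A - 1).range.toSubmodule)).mp this
  · rw [← hD]
    intro z
    -- By density it suffices to treat z = Dy. There UDy = Qy - Ay by the first column, and applying
    -- Q with Q² = Q gives the second column.
    refine hDdense.induction_on (p := fun z => Q.toCLM (U z) =
        -(D.toCLM z : H) + U ((1 - A).toCLM z)) z ?_ ?_
    · exact isClosed_eq (by fun_prop) (by fun_prop)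
    · intro y
      have e1 : (U (D.toCLM y) : H) = Q.toCLM y - A.toCLM y := eq_sub_of_add_eq' (hQ y).symm
      have e2 : D.toCLM (D.toCLM y) = A.toCLM (A.toCLM y) - A.toCLM y :=
        (congrArg (fun T => T.toCLM y) hDD).trans (map_sub A.toCLM _ _)
      have e3 : A.toCLM (D.toCLM y) = D.toCLM (A.toCLM y) := congrArg (fun T => T.toCLM y) hAD
      have e4 : (1 - A).toCLM (D.toCLM y) = D.toCLM y - D.toCLM (A.toCLM y) :=
        congrArg (D.toCLM y - ·) e3
      have e5 := hQ (A.toCLM y)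
      rw [e4, map_sub, e2, e1, map_sub, h.apply_apply', e5, Submodule.coe_sub, Submodule.coe_sub, e1,
        hQ y]
      abel

end IsMatchedPair

/-! ### Relations between A and B = A(2A - 1)⁻¹. -/

section CStar

variable {𝓐 : Type*} [CStarAlgebra 𝓐] [PartialOrder 𝓐] [StarOrderedRing 𝓐]

/-- The relations between `A`, `B = A (2A - 1)⁻¹`, `(A (A - 1))^{1/2}` and `(B (1 - B))^{1/2}`. -/
theorem mul_inverse_two_mul_sub_one {A B D E : 𝓐} (hA : 1 ≤ A)
    (hB : B = A * Ring.inverse (2 * A - 1)) (hD : D = CFC.sqrt A * CFC.sqrt (A - 1))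
    (hE : E = CFC.sqrt B * CFC.sqrt (1 - B)) :
    IsUnit (2 * A - 1) ∧ 0 ≤ B ∧ ‖B‖ ≤ 1 ∧ (2 * A - 1) * B = A ∧ (2 * A - 1) * E = D ∧
      D * B = A * E ∧ D * E = (A - 1) * B := by
  have hA0 : 0 ≤ A := zero_le_one.trans hA
  have hA1 : 0 ≤ A - 1 := sub_nonneg.mpr hA
  have h1 : 1 ≤ 2 * A - 1 := by
    have e : 2 * A - 1 = 1 + ((A - 1) + (A - 1)) := by noncomm_ring
    rw [e]
    exact le_add_of_nonneg_right (add_nonneg hA1 hA1)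
  have hu := isUnit_of_one_le h1
  obtain ⟨R, hR⟩ : ∃ R, R = Ring.inverse (2 * A - 1) := ⟨_, rfl⟩
  have hr1 : (2 * A - 1) * R = 1 := hR ▸ Ring.mul_inverse_cancel _ hu
  have hr2 : R * (2 * A - 1) = 1 := hR ▸ Ring.inverse_mul_cancel _ hu
  have hRcomm : ∀ {a : 𝓐}, A * a = a * A → a * R = R * a := fun {a} h => by
    linear_combination (norm := noncomm_ring) -hr2 * a * R + R * a * hr1 + 2 * R * h * R
  have hAR : A * R = R * A := hRcomm rfl
  have hcomm : Commute A (A - 1) := (Commute.refl A).sub_right (Commute.one_right A)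
  have hDD : D * D = A * (A - 1) := hD ▸ sqrt_mul_sqrt_mul_self hA0 hA1 hcomm
  have hD0 : 0 ≤ D := hD ▸ sqrt_mul_sqrt_nonneg hcomm
  have hAD : A * D = D * A := by
    rw [hD]
    exact ((commute_sqrt_left (Commute.refl A)).mul_left (commute_sqrt_left hcomm.symm)).symm
  have hDR : D * R = R * D := hRcomm hAD
  have hR0 : 0 ≤ R := by
    have hs : star R = R := by
      have := congrArg star hr1
      rw [star_mul, (IsSelfAdjoint.of_nonneg (zero_le_one.trans h1)).star_eq, star_one] at this
      exact left_inv_eq_right_inv this hr1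
    have := star_left_conjugate_nonneg (zero_le_one.trans h1) R
    rwa [hs, hr2, one_mul] at this
  rw [← hR] at hB
  have hB0 : 0 ≤ B := hB ▸ Commute.mul_nonneg hA0 hR0 hAR
  have hB1 : 1 - B = (A - 1) * R := by
    rw [hB]
    linear_combination (norm := noncomm_ring) -hr1
  have hB1' : 0 ≤ 1 - B := by
    rw [hB1]
    refine Commute.mul_nonneg hA1 hR0 ?_
    exact Commute.sub_left hAR (Commute.one_left R)
  -- DR is positive and its square is A(A - 1)R² = B(1 - B), so it is the required product of roots;
  -- the four relations then follow by commuting factors.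
  have hEq : E = D * R := by
    rw [hE]
    refine sqrt_mul_sqrt_eq hB0 hB1' ((Commute.one_right B).sub_right (Commute.refl B))
      (Commute.mul_nonneg hD0 hR0 hDR) ?_
    rw [hB1, hB]
    linear_combination (norm := noncomm_ring) -D * hDR * R + hDD * R * R + A * hAR * R
  refine ⟨hu, hB0, (CStarAlgebra.norm_le_one_iff_of_nonneg B hB0).mpr (sub_nonneg.mp hB1'),
    ?_, ?_, ?_, ?_⟩
  · rw [hB, hAR, ← mul_assoc, hr1, one_mul]
  · rw [hEq, hDR, ← mul_assoc, hr1, one_mul]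
  · rw [hB, hEq, ← mul_assoc, ← hAD, mul_assoc]
  · rw [hB, hEq, ← mul_assoc, hDD, ← mul_assoc, hcomm.eq]

end CStar

/-! ### Orthogonal decomposition along the range of an idempotent. -/

section Projections

variable {𝔄 H : Type*} [NonUnitalCStarAlgebra 𝔄] [PartialOrder 𝔄] [StarOrderedRing 𝔄]
  [NormedAddCommGroup H] [NormedSpace ℂ H] [SMul 𝔄 H] [CStarModule 𝔄 H] {Q : Adjointable 𝔄 H}

/-- `x = y + (x - y)` is the decomposition of `x` along `𝓡(Q)` and its orthogonal complement. -/
def IsRangePart (Q : Adjointable 𝔄 H) (x y : H) : Prop :=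
  Q.toCLM y = y ∧ (star Q).toCLM (x - y) = 0

theorem IsRangePart.add {x y x' y' : H} (h : IsRangePart Q x y) (h' : IsRangePart Q x' y') :
    IsRangePart Q (x + x') (y + y') :=
  ⟨by rw [map_add, h.1, h'.1], by rw [add_sub_add_comm, map_add, h.2, h'.2, add_zero]⟩

theorem inner_range_of_star_apply {x : H} (hx : (star Q).toCLM x = 0) :
    ∀ w ∈ Q.range.toSubmodule, ⟪x, w⟫_𝔄 = 0 := by
  rintro _ ⟨y, rfl⟩
  exact (Adjointable.inner_right Q x y).trans (by rw [hx, CStarModule.inner_zero_left])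

theorem isOrthComplemented_range (h : ∀ x, ∃ y, IsRangePart Q x y) :
    Q.range.IsOrthComplemented := fun x => by
  obtain ⟨y, h1, h2⟩ := h x
  exact ⟨y, ⟨y, h1⟩, x - y, inner_range_of_star_apply h2, (add_sub_cancel y x).symm⟩

theorem IsRangePart.proj_apply (h : Q.range.IsOrthComplemented) {x y : H}
    (hxy : IsRangePart Q x y) : Q.range.proj.toCLM x = y :=
  Sub.projTo_eq h ⟨y, hxy.1⟩ (inner_range_of_star_apply hxy.2) (add_sub_cancel y x).symm

/-- Lets `IsRangePart`, applied to 1 - Q, handle the projection onto the null space as well. -/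
theorem ker_eq_range_one_sub (hQ : Q * Q = Q) : Q.ker = (1 - Q).range := by
  have : Q.ker.toSubmodule = (1 - Q).range.toSubmodule := by
    ext x
    constructor
    · intro hx
      exact ⟨x, (congrArg (x - ·) (show Q.toCLM x = 0 from hx)).trans (sub_zero x)⟩
    · rintro ⟨y, rfl⟩
      change (Q * (1 - Q)).toCLM y = 0
      rw [mul_sub, mul_one, hQ, sub_self]
      rfl
  cases hk : Q.ker
  cases hr : (1 - Q).range
  rw [hk, hr] at this
  congr

theorem isRangePart_one_sub {x y : H} (h1 : Q.toCLM y = 0) (h2 : (star Q).toCLM (x - y) = x - y) :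
    IsRangePart (1 - Q) x y := by
  refine ⟨(congrArg (y - ·) h1).trans (sub_zero y), ?_⟩
  rw [star_sub, star_one]
  exact (congrArg ((x - y) - ·) h2).trans (sub_self _)

end Projections

/-! ### Reading off block matrices. -/

namespace IsMatchedPair

variable {𝔄 H : Type*} [NonUnitalCStarAlgebra 𝔄] [PartialOrder 𝔄] [StarOrderedRing 𝔄]
  [NormedAddCommGroup H] [NormedSpace ℂ H] [SMul 𝔄 H] [CStarModule 𝔄 H] [CompleteSpace H]
  {P Q : Adjointable 𝔄 H}

theorem transported_self (h : IsMatchedPair P Q) (hh : IsHarmonious P Q) :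
    transported P Q P = diagOp 𝔄 1 (diagOp 𝔄 0 (diagOp 𝔄 1 0)) := by
  refine h.transported_eq hh fun v => ?_
  rw [sumOp_apply, map_add, map_add, map_add, (h.apply_of_mem_H₁ v.1.2).1,
    (apply_of_mem_H₄ v.2.1.2).1, h.apply_of_mem_H₅ _ v.2.2.1.2, h.apply_of_mem_H₆ _ v.2.2.2.2]
  change _ = ((v.1 + 0 : (H₁ P Q).Elem) : H) + (((0 + (0 + 0) : (H₄ P Q).Elem) : H) +
    (((0 + (0 + (v.2.2.1 + 0)) : (H₅ P Q).Elem) : H) +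
    ((0 + (0 + (0 + 0)) : (H₆ P Q).Elem) : H)))
  simp

/-- Every vector of H₆ has the form Uz with z in H₅, so testing on Uz keeps U* out of the
hypotheses. -/
theorem transported_eq_blocks (h : IsMatchedPair P Q) (hh : IsHarmonious P Q)
    {T : Adjointable 𝔄 H} {U : (H₅ P Q).Elem →L[ℂ] (H₆ P Q).Elem} (hU : IsUnitaryOp 𝔄 U)
    {s : (H₁ P Q).Elem →L[ℂ] (H₁ P Q).Elem} {t : (H₄ P Q).Elem →L[ℂ] (H₄ P Q).Elem}
    {a b c d : (H₅ P Q).Elem →L[ℂ] (H₅ P Q).Elem}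
    (h1 : ∀ x : (H₁ P Q).Elem, T.toCLM x = s x) (h4 : ∀ x : (H₄ P Q).Elem, T.toCLM x = t x)
    (h5 : ∀ z : (H₅ P Q).Elem, T.toCLM z = a z + U (c z))
    (h6 : ∀ z : (H₅ P Q).Elem, T.toCLM (U z) = b z + U (d z)) :
    transported P Q T = diagOp 𝔄 s (diagOp 𝔄 t
      (blockOp 𝔄 a (b ∘L adj 𝔄 U) (U ∘L c) (U ∘L d ∘L adj 𝔄 U))) := by
  refine h.transported_eq hh fun v => ?_
  have hUU : U (adj 𝔄 U v.2.2.2) = v.2.2.2 := congrArg (fun f => f v.2.2.2) hU.2.2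
  have h6' := h6 (adj 𝔄 U v.2.2.2)
  rw [hUU] at h6'
  rw [sumOp_apply, map_add, map_add, map_add, h1, h4, h5, h6']
  change _ = ((s v.1 + 0 : (H₁ P Q).Elem) : H) + (((0 + (t v.2.1 + 0) : (H₄ P Q).Elem) : H) +
    (((0 + (0 + (a v.2.2.1 + b (adj 𝔄 U v.2.2.2))) : (H₅ P Q).Elem) : H) +
    ((0 + (0 + (U (c v.2.2.1) + U (d (adj 𝔄 U v.2.2.2)))) : (H₆ P Q).Elem) : H)))
  simp only [zero_add, add_zero, Submodule.coe_add]
  abel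

end IsMatchedPair

/-! ### Range and null projections on the generic part. -/

namespace IsMatchedPair

variable {𝔄 H : Type*} [NonUnitalCStarAlgebra 𝔄] [PartialOrder 𝔄] [StarOrderedRing 𝔄]
  [NormedAddCommGroup H] [NormedSpace ℂ H] [SMul 𝔄 H] [CStarModule 𝔄 H] [CompleteSpace H]
  {P Q : Adjointable 𝔄 H}

section Generic

variable {A B D E : Adjointable 𝔄 (H₅ P Q).Elem} {U : (H₅ P Q).Elem →L[ℂ] (H₆ P Q).Elem}

theorem star_apply_H₅ (h : IsMatchedPair P Q)
    (h5 : ∀ z : (H₅ P Q).Elem, Q.toCLM z = A.toCLM z + U (D.toCLM z)) (z : (H₅ P Q).Elem) :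
    (star Q).toCLM z = A.toCLM z - U (D.toCLM z) := by
  rw [h.star_apply_of_range (h.apply_of_mem_H₅ _ z.2), h5, map_add, h.apply_of_mem_H₅ _ (A.toCLM z).2,
    h.apply_of_mem_H₆ _ (U (D.toCLM z)).2, add_zero, two_smul]
  abel

theorem star_apply_H₆ (h : IsMatchedPair P Q)
    (h6 : ∀ z : (H₅ P Q).Elem, Q.toCLM (U z) = -(D.toCLM z : H) + U ((1 - A).toCLM z))
    (z : (H₅ P Q).Elem) :
    (star Q).toCLM (U z) = D.toCLM z + U ((1 - A).toCLM z) := by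
  rw [h.star_apply_of_ker (h.apply_of_mem_H₆ _ (U z).2), h6, map_add, map_neg,
    h.apply_of_mem_H₅ _ (D.toCLM z).2, h.apply_of_mem_H₆ _ (U ((1 - A).toCLM z)).2, add_zero,
    two_smul]
  abel

theorem star_apply_H₁ (h : IsMatchedPair P Q) (x : (H₁ P Q).Elem) : (star Q).toCLM x = x := by
  obtain ⟨h1, h2⟩ := h.apply_of_mem_H₁ x.2
  rw [h.star_apply_of_range h1, h2, h1, two_smul, add_sub_cancel_right]

theorem star_apply_H₄ (h : IsMatchedPair P Q) (x : (H₄ P Q).Elem) : (star Q).toCLM x = 0 := by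
  obtain ⟨h1, h2⟩ := apply_of_mem_H₄ x.2
  rw [h.star_apply_of_ker h1, h2, map_zero, smul_zero, sub_zero]

/-- The pair (a, b) stands for the column z ↦ az + Ubz, on which Q acts as the matrix (A, -D; D, 1 -
A) over 𝓛(H₅). For Q* the signs of the off-diagonal entries flip. -/
theorem apply_generic
    (h5 : ∀ z : (H₅ P Q).Elem, Q.toCLM z = A.toCLM z + U (D.toCLM z))
    (h6 : ∀ z : (H₅ P Q).Elem, Q.toCLM (U z) = -(D.toCLM z : H) + U ((1 - A).toCLM z))
    (a b : Adjointable 𝔄 (H₅ P Q).Elem) (z : (H₅ P Q).Elem) :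
    Q.toCLM ((a.toCLM z : H) + (U (b.toCLM z) : H)) =
      ((A * a - D * b).toCLM z : H) + (U ((D * a + (1 - A) * b).toCLM z) : H) := by
  have e1 : ((A * a - D * b).toCLM z : H) = A.toCLM (a.toCLM z) - D.toCLM (b.toCLM z) := rfl
  have e2 : (D * a + (1 - A) * b).toCLM z = D.toCLM (a.toCLM z) + (1 - A).toCLM (b.toCLM z) := rfl
  rw [map_add, h5, h6, e1, e2, map_add, Submodule.coe_add]
  abel

theorem star_apply_generic (h : IsMatchedPair P Q)
    (h5 : ∀ z : (H₅ P Q).Elem, Q.toCLM z = A.toCLM z + U (D.toCLM z))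
    (h6 : ∀ z : (H₅ P Q).Elem, Q.toCLM (U z) = -(D.toCLM z : H) + U ((1 - A).toCLM z))
    (a b : Adjointable 𝔄 (H₅ P Q).Elem) (z : (H₅ P Q).Elem) :
    (star Q).toCLM ((a.toCLM z : H) + (U (b.toCLM z) : H)) =
      ((A * a + D * b).toCLM z : H) + (U (((1 - A) * b - D * a).toCLM z) : H) := by
  have e1 : ((A * a + D * b).toCLM z : H) = A.toCLM (a.toCLM z) + D.toCLM (b.toCLM z) := rfl
  have e2 : ((1 - A) * b - D * a).toCLM z = (1 - A).toCLM (b.toCLM z) - D.toCLM (a.toCLM z) := rfl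
  rw [map_add, h.star_apply_H₅ h5, h.star_apply_H₆ h6, e1, e2, map_sub, Submodule.coe_sub]
  abel

/-- With y the column (a, b) and x the column (c, d), `e1` and `e2` encode Qy = y, while `e3` and
`e4` encode Q*(x - y) = 0. -/
theorem isRangePart_of_identities (h : IsMatchedPair P Q)
    (h5 : ∀ z : (H₅ P Q).Elem, Q.toCLM z = A.toCLM z + U (D.toCLM z))
    (h6 : ∀ z : (H₅ P Q).Elem, Q.toCLM (U z) = -(D.toCLM z : H) + U ((1 - A).toCLM z))
    {a b c d : Adjointable 𝔄 (H₅ P Q).Elem} (e1 : A * a - D * b = a) (e2 : D * a + (1 - A) * b = b)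
    (e3 : A * (c - a) + D * (d - b) = 0) (e4 : (1 - A) * (d - b) - D * (c - a) = 0)
    (z : (H₅ P Q).Elem) :
    IsRangePart Q ((c.toCLM z : H) + (U (d.toCLM z) : H))
      ((a.toCLM z : H) + (U (b.toCLM z) : H)) := by
  refine ⟨by rw [apply_generic h5 h6, e1, e2], ?_⟩
  have e : ((c.toCLM z : H) + (U (d.toCLM z) : H)) - ((a.toCLM z : H) + (U (b.toCLM z) : H)) =
      ((c - a).toCLM z : H) + (U ((d - b).toCLM z) : H) := by
    simp only [Adjointable.toCLM_sub, sub_apply, map_sub, Submodule.coe_sub]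
    abel
  rw [e, h.star_apply_generic h5 h6, e3, e4]
  simp

theorem isRangePart_one_sub_of_identities (h : IsMatchedPair P Q)
    (h5 : ∀ z : (H₅ P Q).Elem, Q.toCLM z = A.toCLM z + U (D.toCLM z))
    (h6 : ∀ z : (H₅ P Q).Elem, Q.toCLM (U z) = -(D.toCLM z : H) + U ((1 - A).toCLM z))
    {a b c d : Adjointable 𝔄 (H₅ P Q).Elem} (e1 : A * a - D * b = 0) (e2 : D * a + (1 - A) * b = 0)
    (e3 : A * (c - a) + D * (d - b) = c - a) (e4 : (1 - A) * (d - b) - D * (c - a) = d - b)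
    (z : (H₅ P Q).Elem) :
    IsRangePart (1 - Q) ((c.toCLM z : H) + (U (d.toCLM z) : H))
      ((a.toCLM z : H) + (U (b.toCLM z) : H)) := by
  refine isRangePart_one_sub (by rw [apply_generic h5 h6, e1, e2]; simp) ?_
  have e : ((c.toCLM z : H) + (U (d.toCLM z) : H)) - ((a.toCLM z : H) + (U (b.toCLM z) : H)) =
      ((c - a).toCLM z : H) + (U ((d - b).toCLM z) : H) := by
    simp only [Adjointable.toCLM_sub, sub_apply, map_sub, Submodule.coe_sub]
    abel
  rw [e, h.star_apply_generic h5 h6, e3, e4]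

/-- Here x is a basis column, (1, 0) or (0, 1), and y is the matching column of the claimed
projection matrix. Each entry of the test is an integer combination of `k1` to `k4`. -/
theorem isRangePart_generic (h : IsMatchedPair P Q)
    (h5 : ∀ z : (H₅ P Q).Elem, Q.toCLM z = A.toCLM z + U (D.toCLM z))
    (h6 : ∀ z : (H₅ P Q).Elem, Q.toCLM (U z) = -(D.toCLM z : H) + U ((1 - A).toCLM z))
    (k1 : (2 * A - 1) * B = A) (k2 : (2 * A - 1) * E = D) (k3 : D * B = A * E)
    (k4 : D * E = (A - 1) * B) (z : (H₅ P Q).Elem) :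
    IsRangePart Q (z : H) ((B.toCLM z : H) + (U (E.toCLM z) : H)) ∧
    IsRangePart Q (U z : H) ((E.toCLM z : H) + (U ((1 - B).toCLM z) : H)) ∧
    IsRangePart (1 - Q) (z : H) (((1 - B).toCLM z : H) + (U (E.toCLM z) : H)) ∧
    IsRangePart (1 - Q) (U z : H) ((E.toCLM z : H) + (U (B.toCLM z) : H)) := by
  have hz : (z : H) = ((1 : Adjointable 𝔄 (H₅ P Q).Elem).toCLM z : H) +
    (U ((0 : Adjointable 𝔄 (H₅ P Q).Elem).toCLM z) : H) := by simp
  have hUz : (U z : H) = ((0 : Adjointable 𝔄 (H₅ P Q).Elem).toCLM z : H) +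
    (U ((1 : Adjointable 𝔄 (H₅ P Q).Elem).toCLM z) : H) := by simp
  refine ⟨?_, ?_, ?_, ?_⟩
  · refine (congrArg (fun t => IsRangePart Q t _) hz).mpr
      (h.isRangePart_of_identities h5 h6 ?_ ?_ ?_ ?_ z)
    · linear_combination (norm := noncomm_ring) -k4
    · linear_combination (norm := noncomm_ring) k3
    · linear_combination (norm := noncomm_ring) -k1 - k4
    · linear_combination (norm := noncomm_ring) k2 + k3
  · refine (congrArg (fun t => IsRangePart Q t _) hUz).mpr
      (h.isRangePart_of_identities h5 h6 ?_ ?_ ?_ ?_ z)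
    · linear_combination (norm := noncomm_ring) k2 + k3
    · linear_combination (norm := noncomm_ring) k4 + k1
    · linear_combination (norm := noncomm_ring) k3
    · linear_combination (norm := noncomm_ring) k4
  · refine (congrArg (fun t => IsRangePart (1 - Q) t _) hz).mpr
      (h.isRangePart_one_sub_of_identities h5 h6 ?_ ?_ ?_ ?_ z)
    · linear_combination (norm := noncomm_ring) -k1 - k4
    · linear_combination (norm := noncomm_ring) -k2 - k3
    · linear_combination (norm := noncomm_ring) -k4
    · linear_combination (norm := noncomm_ring) -k3
  · refine (congrArg (fun t => IsRangePart (1 - Q) t _) hUz).mpr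
      (h.isRangePart_one_sub_of_identities h5 h6 ?_ ?_ ?_ ?_ z)
    · linear_combination (norm := noncomm_ring) -k3
    · linear_combination (norm := noncomm_ring) k4
    · linear_combination (norm := noncomm_ring) -k2 - k3
    · linear_combination (norm := noncomm_ring) k4 + k1

end Generic

/-- Range parts add, so they need only be found on the four summands, with H₆ reached through U. -/
theorem exists_isRangePart (h : IsMatchedPair P Q) (hh : IsHarmonious P Q) {T : Adjointable 𝔄 H}
    {U : (H₅ P Q).Elem →L[ℂ] (H₆ P Q).Elem} (hU : IsUnitaryOp 𝔄 U)
    (h1 : ∀ x : (H₁ P Q).Elem, ∃ y, IsRangePart T x y)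
    (h4 : ∀ x : (H₄ P Q).Elem, ∃ y, IsRangePart T x y)
    (h5 : ∀ x : (H₅ P Q).Elem, ∃ y, IsRangePart T x y)
    (h6 : ∀ x : (H₅ P Q).Elem, ∃ y, IsRangePart T (U x) y) (x : H) : ∃ y, IsRangePart T x y := by
  obtain ⟨v, rfl⟩ := h.exists_sumOp_eq hh x
  have hUU : U (adj 𝔄 U v.2.2.2) = v.2.2.2 := congrArg (fun f => f v.2.2.2) hU.2.2
  obtain ⟨y₁, hy₁⟩ := h1 v.1
  obtain ⟨y₄, hy₄⟩ := h4 v.2.1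
  obtain ⟨y₅, hy₅⟩ := h5 v.2.2.1
  obtain ⟨y₆, hy₆⟩ := h6 (adj 𝔄 U v.2.2.2)
  rw [hUU] at hy₆
  exact ⟨_, hy₁.add (hy₄.add (hy₅.add hy₆))⟩

end IsMatchedPair

end HilbertMod

end

open HilbertMod in
theorem mainTheorem8 {𝔄 H : Type*} [NonUnitalCStarAlgebra 𝔄] [PartialOrder 𝔄]
    [StarOrderedRing 𝔄] [NormedAddCommGroup H] [NormedSpace ℂ H] [SMul 𝔄 H] [CStarModule 𝔄 H]
    [CompleteSpace H] (Q : Adjointable 𝔄 H) (hQ : IsIdempotentElem Q)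
    (hQ_proj : ¬ IsSelfAdjoint Q) (hharm : IsHarmonious (matchedProj Q) Q) :
    ((H₁ (matchedProj Q) Q).IsOrthComplemented ∧ (H₄ (matchedProj Q) Q).IsOrthComplemented ∧
      Q.range.IsOrthComplemented ∧ Q.ker.IsOrthComplemented ∧
      IsUnitaryOp 𝔄 (decompOp (matchedProj Q) Q)) ∧
    ∃ (A : Adjointable 𝔄 (H₅ (matchedProj Q) Q).Elem)
      (U : (H₅ (matchedProj Q) Q).Elem →L[ℂ] (H₆ (matchedProj Q) Q).Elem),
      1 ≤ A ∧ (A - 1).range.closure.toSubmodule = ⊤ ∧ IsUnitaryOp 𝔄 U ∧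
      transported (matchedProj Q) Q (matchedProj Q) =
        diagOp 𝔄 1 (diagOp 𝔄 0 (diagOp 𝔄 1 0)) ∧
      transported (matchedProj Q) Q Q =
        diagOp 𝔄 1 (diagOp 𝔄 0 (blockOp 𝔄
          A.toCLM
          (-((CFC.sqrt A * CFC.sqrt (A - 1)).toCLM ∘L adj 𝔄 U))
          (U ∘L (CFC.sqrt A * CFC.sqrt (A - 1)).toCLM)
          (U ∘L (1 - A).toCLM ∘L adj 𝔄 U))) ∧
      IsUnit (2 * A - 1) ∧
      ∃ B : Adjointable 𝔄 (H₅ (matchedProj Q) Q).Elem,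
        B = A * Ring.inverse (2 * A - 1) ∧ 0 ≤ B ∧ ‖B‖ ≤ 1 ∧
        transported (matchedProj Q) Q Q.range.proj =
          diagOp 𝔄 1 (diagOp 𝔄 0 (blockOp 𝔄
            B.toCLM
            ((CFC.sqrt B * CFC.sqrt (1 - B)).toCLM ∘L adj 𝔄 U)
            (U ∘L (CFC.sqrt B * CFC.sqrt (1 - B)).toCLM)
            (U ∘L (1 - B).toCLM ∘L adj 𝔄 U))) ∧
        transported (matchedProj Q) Q Q.ker.proj =
          diagOp 𝔄 0 (diagOp 𝔄 1 (blockOp 𝔄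
            (1 - B).toCLM
            ((CFC.sqrt B * CFC.sqrt (1 - B)).toCLM ∘L adj 𝔄 U)
            (U ∘L (CFC.sqrt B * CFC.sqrt (1 - B)).toCLM)
            (U ∘L B.toCLM ∘L adj 𝔄 U))) := by
  have h := isMatchedPair_matchedProj hQ.eq
  obtain ⟨A, U, hA, hAd, hU, h5, h6⟩ := h.exists_generic_part hharm
  obtain ⟨B, hB⟩ : ∃ B, B = A * Ring.inverse (2 * A - 1) := ⟨_, rfl⟩
  obtain ⟨hu, hB0, hB1, k1, k2, k3, k4⟩ := mul_inverse_two_mul_sub_one hA hB rfl rfl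
  have hpart := h.isRangePart_generic h5 h6 k1 k2 k3 k4
  have r1 : ∀ x : (H₁ (matchedProj Q) Q).Elem, IsRangePart Q (x : H) x := fun x =>
    ⟨(h.apply_of_mem_H₁ x.2).2, by rw [sub_self, map_zero]⟩
  have r4 : ∀ x : (H₄ (matchedProj Q) Q).Elem, IsRangePart Q (x : H) 0 := fun x =>
    ⟨map_zero _, by rw [sub_zero, h.star_apply_H₄]⟩
  have q1 : ∀ x : (H₁ (matchedProj Q) Q).Elem, IsRangePart (1 - Q) (x : H) 0 := fun x =>
    isRangePart_one_sub (map_zero _) (by rw [sub_zero, h.star_apply_H₁])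
  have q4 : ∀ x : (H₄ (matchedProj Q) Q).Elem, IsRangePart (1 - Q) (x : H) x := fun x =>
    isRangePart_one_sub x.2.2 (by rw [sub_self, map_zero])
  have hR : Q.range.IsOrthComplemented := isOrthComplemented_range <|
    h.exists_isRangePart hharm hU (fun x => ⟨_, r1 x⟩) (fun x => ⟨_, r4 x⟩)
      (fun x => ⟨_, (hpart x).1⟩) fun x => ⟨_, (hpart x).2.1⟩
  have hK : (1 - Q).range.IsOrthComplemented := isOrthComplemented_range <|
    h.exists_isRangePart hharm hU (fun x => ⟨_, q1 x⟩) (fun x => ⟨_, q4 x⟩)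
      (fun x => ⟨_, (hpart x).2.2.1⟩) fun x => ⟨_, (hpart x).2.2.2⟩
  have hker : Q.ker = (1 - Q).range := ker_eq_range_one_sub hQ.eq
  refine ⟨⟨h.isOrthComplemented_H₁ hharm, h.isOrthComplemented_H₄ hharm, hR, hker ▸ hK,
    h.isUnitaryOp_decompOp hharm⟩, A, U, hA, hAd, hU, h.transported_self hharm, ?_, hu, B, hB, hB0,
    hB1, ?_, ?_⟩
  · rw [← ContinuousLinearMap.neg_comp]
    exact h.transported_eq_blocks hharm hU (fun x => (h.apply_of_mem_H₁ x.2).2) (fun x => x.2.2)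
      h5 h6
  · exact h.transported_eq_blocks hharm hU (fun x => (r1 x).proj_apply hR)
      (fun x => (r4 x).proj_apply hR) (fun x => (hpart x).1.proj_apply hR)
      fun x => (hpart x).2.1.proj_apply hR
  · rw [hker]
    exact h.transported_eq_blocks hharm hU (fun x => (q1 x).proj_apply hK)
      (fun x => (q4 x).proj_apply hK) (fun x => (hpart x).2.2.1.proj_apply hK)
      fun x => (hpart x).2.2.2.proj_apply hK
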